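/- Let $n\ge 1$. Consider the grid with nodes $(x,y)$, $1\le x,y\le n$. In the 20-vertex model the edges are all horizontal, vertical and diagonal unit segments $(x,y)-(x+1,y)$, $(x,y)-(x,y+1)$, $(x,y+1)-(x+1,y)$ with at least one end point in the grid; in the 6-vertex model only the horizontal and vertical ones are kept. A configuration is an orientation of all edges such that every grid node has as many incoming as outgoing edges (three of each for 20V, two of each for 6V) and such that the boundary edges satisfy the following domain wall boundary conditions. Call an edge occupied if it is oriented from West to East, from North to South, or from Northwest to Southeast, respectively. Then the edges starting at a point $(0,y)$ and the edges ending at a point $(x,0)$ (for this reference orientation) are occupied, including, for 20V, the two corner edges $(0,n+1)\to(1,n)$ and $(n,1)\to(n+1,0)$ (this is the prescription DWBC1), and all other boundary edges are unoccupied. The occupied edges are concatenated at each node, in the unique non-crossing way, into osculating paths going from the West boundary to the South boundary. The uppermost path is the one that starts with the edge $(0,n+1)\to(1,n)$ for 20V, and with the edge $(0,n)\to(1,n)$ for 6V. For $1\le \ell\le n$ let $Z^{20V_{BC1}}_\ell$ be the number of 20V configurations whose uppermost path first hits the vertical line $x=n$ at the node $(n,\ell)$. Let $Z^{6V}_{[1,\sqrt2,1];\ell}$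 be the sum, over the 6V configurations whose uppermost path first hits the line $x=n$ at $(n,\ell)$, of the product of the node weights, where a node has weight $a=1$ if its four edges are all occupied or all unoccupied, weight $b=\sqrt2$ if it is traversed by a single path going straight horizontally or vertically, and weight $c=1$ if it is visited by a single path, which turns. Set $$\hat Z^{20V_{BC1}}(\tau)=\sum_{\ell=1}^n Z^{20V_{BC1}}_\ell\,\tau^{\ell-1},\qquad \hat Z^{6V}_{[1,\sqrt2,1]}(\sigma)=\sum_{\ell=1}^n Z^{6V}_{[1,\sqrt2,1];\ell}\,\sigma^{\ell-1}.$$ Then for every complex $\tau\neq-1$, $$\hat Z^{20V_{BC1}}(\tau)=\frac{2\tau}{1+\tau}\,\hat Z^{6V}_{[1,\sqrt2,1]}\!\left(\frac{1+\tau}{2}\right)+\frac{1-\tau}{1+\tau}\,\hat Z^{6V}_{[1,\sqrt2,1]}(0).$$ -/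

import Mathlib

namespace VertexModel

/-- The three families of parallel lines of the straightened triangular lattice. -/
inductive Dir
  | horizontal
  | diagonal
  | vertical
  deriving DecidableEq

/-- An edge `(δ, x, y)`, where `(x, y)` is the lower left corner of the bounding box of the
edge; its end points are given by `src` and `tgt`. -/
abbrev Edge := Dir × ℕ × ℕ

/-- Starting point of an edge for its natural orientation (from West to East, from North to
South, from Northwest to Southeast). -/
def src : Edge → ℕ × ℕ
  | (.horizontal, x, y) => (x, y)
  | (.vertical, x, y) => (x, y + 1)
  | (.diagonal, x, y) => (x, y + 1)

/-- End point of an edge for its natural orientation. -/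
def tgt : Edge → ℕ × ℕ
  | (.horizontal, x, y) => (x + 1, y)
  | (.vertical, x, y) => (x, y)
  | (.diagonal, x, y) => (x + 1, y)

/-- The nodes `(x, y)`, `1 ≤ x, y ≤ n`, of the `n × n` grid; `x` numbers the vertical lines from
left to right, `y` numbers the horizontal lines from bottom to top. -/
def grid (n : ℕ) : Finset (ℕ × ℕ) := Finset.Icc 1 n ×ˢ Finset.Icc 1 n

/-- The inner and boundary edges of the domain: all edges in the directions `D` with at least
one end point in the grid. -/
def edges (D : Finset Dir) (n : ℕ) : Finset Edge :=
  (D ×ˢ Finset.range (n + 1) ×ˢ Finset.range (n + 1)).filter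
    fun e => src e ∈ grid n ∨ tgt e ∈ grid n

/-- Directions of the edges in the six-vertex model on the square lattice. -/
def dirs6V : Finset Dir := {.horizontal, .vertical}

/-- Directions of the edges in the twenty-vertex model on the triangular lattice. -/
def dirs20V : Finset Dir := {.horizontal, .diagonal, .vertical}

/- An orientation of the edges is encoded by the set `ω` of those edges whose actual orientation
is the natural one. These are the edges occupied by path steps. -/

/-- The edge `e`, with its actual orientation, points to the node `p`. -/
def PointsTo (ω : Finset Edge) (e : Edge) (p : ℕ × ℕ) : Prop :=
  (e ∈ ω ∧ tgt e = p) ∨ (e ∉ ω ∧ src e = p)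

/-- The edge `e`, with its actual orientation, points away from the node `p`. -/
def PointsFrom (ω : Finset Edge) (e : Edge) (p : ℕ × ℕ) : Prop :=
  (e ∈ ω ∧ src e = p) ∨ (e ∉ ω ∧ tgt e = p)

open Classical in
/-- The ice rule: every node of the grid has as many incoming as outgoing edges, namely three of
each on the triangular lattice and two of each on the square lattice. -/
def IceRule (D : Finset Dir) (n : ℕ) (ω : Finset Edge) : Prop :=
  ∀ p ∈ grid n,
    ((edges D n).filter fun e => PointsTo ω e p).card = D.card ∧
    ((edges D n).filter fun e => PointsFrom ω e p).card = D.card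

/-- Domain wall boundary conditions. On the square lattice these are the usual ones. On the
triangular lattice these are the conditions DWBC1: the edge from `(0, n+1)` to `(1, n)` is
covered by `west`, the edge from `(n, 1)` to `(n+1, 0)` is covered by `south`, and both have
their natural orientation. -/
structure IsDWBC1 (D : Finset Dir) (n : ℕ) (ω : Finset Edge) : Prop where
  west : ∀ e ∈ edges D n, (src e).1 = 0 → e ∈ ω
  south : ∀ e ∈ edges D n, (tgt e).2 = 0 → e ∈ ω
  east : ∀ e ∈ edges D n, (tgt e).1 = n + 1 → (tgt e).2 ≠ 0 → e ∉ ω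
  north : ∀ e ∈ edges D n, (src e).2 = n + 1 → (src e).1 ≠ 0 → e ∉ ω

open Classical in
/-- The configurations of the model with domain wall boundary conditions. -/
noncomputable def configs (D : Finset Dir) (n : ℕ) : Finset (Finset Edge) :=
  (edges D n).powerset.filter fun ω => IsDWBC1 D n ω ∧ IceRule D n ω

/-- Seen as incoming edges of a node, edges of larger level lie above those of smaller level
(North above Northwest above West). Seen as outgoing edges of a node, edges of smaller level lie
above those of larger level (East above Southeast above South). -/
def level : Dir → ℕ
  | .horizontal => 0
  | .diagonal => 1
  | .vertical => 2

/-- The non-crossing concatenation of path steps: the step `e` into a node is followed by the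
step `f` out of it if there are as many steps into the node above `e` as there are steps out of
the node above `f`. -/
def Follows (ω : Finset Edge) (e f : Edge) : Prop :=
  e ∈ ω ∧ f ∈ ω ∧ tgt e = src f ∧
    (ω.filter fun e' => tgt e' = tgt e ∧ level e.1 < level e'.1).card =
      (ω.filter fun f' => src f' = src f ∧ level f'.1 < level f.1).card

/-- The osculating path which starts with the edge `s` first hits the vertical line `x = n` at
the node `(n, l)`: it has a step from outside this line to this node (the abscissa never
decreases along a path). -/
def FirstHits (n : ℕ) (ω : Finset Edge) (s : Edge) (l : ℕ) : Prop :=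
  ∃ e, Relation.ReflTransGen (Follows ω) s e ∧ (src e).1 ≠ n ∧ tgt e = (n, l)

/-- First step of the uppermost path of the twenty-vertex model with DWBC1: the corner edge from
`(0, n+1)` to `(1, n)`. -/
def start20V (n : ℕ) : Edge := (.diagonal, 0, n)

/-- First step of the uppermost path of the six-vertex model: the edge from `(0, n)` to
`(1, n)`. -/
def start6V (n : ℕ) : Edge := (.horizontal, 0, n)

open Classical in
/-- Number of configurations of the twenty-vertex model with DWBC1 whose uppermost path first
hits the last column at height `l`. -/
noncomputable def Z20VBC1 (n l : ℕ) : ℕ :=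
  ((configs dirs20V n).filter fun ω => FirstHits n ω (start20V n) l).card

/-- The refined generating polynomial of the twenty-vertex model with DWBC1. -/
noncomputable def hatZ20VBC1 (n : ℕ) (τ : ℂ) : ℂ :=
  ∑ l ∈ Finset.Icc 1 n, (Z20VBC1 n l : ℂ) * τ ^ (l - 1)

open Classical in
/-- Weight of the node `(x, y)` in a six-vertex configuration: `a` if its four edges are all
occupied or all unoccupied, `b` if it is traversed by one path going straight horizontally or
vertically, and `c` if it is visited by one path, which turns. The edges are those from the West,
to the East, from the North and to the South. -/
noncomputable def nodeWeight (a b c : ℂ) (ω : Finset Edge) (p : ℕ × ℕ) : ℂ :=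
  let W : Prop := (Dir.horizontal, p.1 - 1, p.2) ∈ ω
  let E : Prop := (Dir.horizontal, p.1, p.2) ∈ ω
  let N : Prop := (Dir.vertical, p.1, p.2) ∈ ω
  let S : Prop := (Dir.vertical, p.1, p.2 - 1) ∈ ω
  if (W ↔ N) ∧ (W ↔ E) ∧ (W ↔ S) then a
  else if (W ↔ E) ∧ (N ↔ S) then b
  else c

open Classical in
/-- Partition function, with weights `a, b, c`, of the configurations of the six-vertex model
with domain wall boundary conditions whose uppermost path first hits the last column at
height `l`. -/
noncomputable def Z6V (a b c : ℂ) (n l : ℕ) : ℂ :=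
  ∑ ω ∈ (configs dirs6V n).filter fun ω => FirstHits n ω (start6V n) l,
    ∏ p ∈ grid n, nodeWeight a b c ω p

/-- The refined generating polynomial of the six-vertex model with domain wall boundary
conditions and weights `a, b, c`. -/
noncomputable def hatZ6V (a b c : ℂ) (n : ℕ) (σ : ℂ) : ℂ :=
  ∑ l ∈ Finset.Icc 1 n, Z6V a b c n l * σ ^ (l - 1)

end VertexModel

namespace VertexModel

open Finset

/-! ### Summation over Boolean vectors -/

section BoolVectors

variable {m : ℕ}

/-! The six-vertex weights `1, √2, 1` satisfy `c² = a² + b² - √2·a·b`, and so do the weights `1,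
√2σ, c` once `c² = 1 + 2σ² - 2σ`. All these weights therefore belong to one integrable family. A
triangular-lattice node splits into three pairwise crossings of its horizontal, vertical and
diagonal lines. With `1, √2, 1` the resulting weight is 1 for every ice state (`weight20_one`), so
the 20V sum is a plain count. The second weights are used in the last column only.

The Yang–Baxter equation (`weight20_eq`) lets a diagonal pass from one side of a node to the other.
The antidiagonal of nodes cuts the square into two triangles. On the legs of the lower one all lines
and diagonals are occupied, on those of the upper one all are unoccupied. Hence a diagonal pushed
towards the right angle has trivial crossings at its ends and finally leaves with weight 1
(`triZ_remove_diagonals`). Removing all diagonals from both triangles turns the modified 20V sum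
into the modified 6V sum (`marginal_weight20_eq_weight6`, `sum_configs_weight20_eq`).

The modified column depends on the configuration only through the height `l` of its highest visited
node, where the uppermost path enters it (`LocalRules.exists_last_column`). Its relative weight is
`c σ^(l-1)` for 6V; for 20V it is `c` if `l = 1` and `c σ (2σ-1)^(l-2)` otherwise (`exists_height6`,
`exists_height20`). Cancelling `c` gives `sum_Z20VBC1_mul_columnWeight`, an identity of polynomials
in `σ`. The theorem follows by combining its values at `σ = (1+τ)/2`, where `2σ-1 = τ`, and at `σ =
0`. -/

lemma sum_bool_cons (G : (Fin (m + 1) → Bool) → ℂ) :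
    ∑ x, G x = ∑ t, ∑ x : Fin m → Bool, G (Fin.cons t x) := by
  rw [← (Fin.consEquiv fun _ => Bool).sum_comp, Fintype.sum_prod_type]
  rfl

lemma sum_bool_snoc (G : (Fin (m + 1) → Bool) → ℂ) :
    ∑ x, G x = ∑ t, ∑ x : Fin m → Bool, G (Fin.snoc x t) := by
  rw [← (Fin.snocEquiv fun _ => Bool).sum_comp, Fintype.sum_prod_type]
  rfl

lemma prod_sum_bool {ι : Type*} [Fintype ι] [DecidableEq ι] (G : ι → Bool → ℂ) :
    ∏ i, ∑ t, G i t = ∑ x : ι → Bool, ∏ i, G i (x i) := by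
  rw [Finset.prod_univ_sum, Fintype.piFinset_univ]

lemma prod_sum_bool₃ {ι : Type*} [Fintype ι] [DecidableEq ι] (G : ι → Bool → Bool → Bool → ℂ) :
    ∏ i, ∑ t, ∑ u, ∑ v, G i t u v =
      ∑ x : ι → Bool, ∑ y : ι → Bool, ∑ z : ι → Bool, ∏ i, G i (x i) (y i) (z i) := by
  rw [prod_sum_bool]
  refine sum_congr rfl fun x _ => ?_
  rw [prod_sum_bool]
  refine sum_congr rfl fun y _ => ?_
  rw [prod_sum_bool]

lemma sum_comm₆ {α β γ δ ε ζ : Type*} [Fintype α] [Fintype β] [Fintype γ] [Fintype δ] [Fintype ε]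
    [Fintype ζ] (G : α → β → γ → δ → ε → ζ → ℂ) :
    ∑ a, ∑ b, ∑ c, ∑ d, ∑ e, ∑ z, G a b c d e z = ∑ e, ∑ z, ∑ c, ∑ a, ∑ b, ∑ d, G a b c d e z := by
  simp only [← Fintype.sum_prod_type']
  exact Fintype.sum_equiv ⟨fun x => (x.2.2.2.2.1, x.2.2.2.2.2, x.2.2.1, x.1, x.2.1, x.2.2.2.1),
    fun x => (x.2.2.2.1, x.2.2.2.2.1, x.2.2.1, x.2.2.2.2.2, x.1, x.2.1), fun _ => rfl,
    fun _ => rfl⟩ _ _ fun _ => rfl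

lemma sum_comm₄ {α β γ δ : Type*} [Fintype α] [Fintype β] [Fintype γ] [Fintype δ]
    (G : α → β → γ → δ → ℂ) :
    ∑ a, ∑ b, ∑ c, ∑ d, G a b c d = ∑ c, ∑ d, ∑ b, ∑ a, G a b c d := by
  simp only [← Fintype.sum_prod_type']
  exact Fintype.sum_equiv ⟨fun x => (x.2.2.1, x.2.2.2, x.2.1, x.1),
    fun x => (x.2.2.2, x.2.2.1, x.1, x.2.1), fun _ => rfl, fun _ => rfl⟩ _ _ fun _ => rfl

end BoolVectors

/-! ### Triangular regions and the removal of diagonal lines -/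

section Triangle

/-- Partition function of a triangular region, made of layers `k = 0, 1, …, m - 1` parallel to the
hypotenuse. The node `i ≤ k` of layer `k` is crossed by a first and a second line and by
the diagonal of the layer; its weight is `w k i A B a b d d'` where `A, a` are the states of the
first line away from and towards the right angle, `B, b` those of the second line, and `d, d'`
those of the diagonal before and after the node. -/
noncomputable def triZ (w : ℕ → ℕ → Bool → Bool → Bool → Bool → Bool → Bool → ℂ) :
    (m : ℕ) → (Fin m → Bool) → (Fin m → Bool) → ℂ
  | 0, _, _ => 1
  | m + 1, A, B => ∑ a : Fin (m + 1) → Bool, ∑ b : Fin (m + 1) → Bool, ∑ d : Fin (m + 2) → Bool,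
      (∏ i : Fin (m + 1), w m i (A i) (B i) (a i) (b i) (d i.castSucc) (d i.succ)) *
        triZ w m (fun i => a i.succ) (fun i => b i.castSucc)

/-- The weight `w`, with the state `f` imposed on the lines and `g` on the diagonals
at the legs of the triangle. -/
noncomputable def frozen (f g : Bool) (w : ℕ → ℕ → Bool → Bool → Bool → Bool → Bool → Bool → ℂ)
    (k i : ℕ) (A B a b d d' : Bool) : ℂ :=
  if (i = 0 → a = f ∧ d = g) ∧ (i = k → b = f ∧ d' = g) then w k i A B a b d d' else 0

variable (f : Bool) (R : ℕ → ℕ → Bool → Bool → Bool → Bool → ℂ)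
  (W : ℕ → ℕ → Bool → Bool → Bool → Bool → Bool → Bool → ℂ)
  (P Q : ℕ → Bool → Bool → Bool → Bool → ℂ)

/-- Adding a layer without diagonal, with state `f` at both ends. -/
noncomputable def step6 (m : ℕ) (F : (Fin m → Bool) → (Fin m → Bool) → ℂ)
    (A B : Fin (m + 1) → Bool) : ℂ :=
  ∑ a : Fin m → Bool, ∑ b : Fin m → Bool,
    (∏ i : Fin (m + 1), R m i (A i) (B i) ((Fin.cons f a : Fin (m + 1) → Bool) i)
      ((Fin.snoc b f : Fin (m + 1) → Bool) i)) * F a b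

/-- Adding a layer with diagonal, with state `f` at both ends. -/
noncomputable def step20 (m : ℕ) (F : (Fin m → Bool) → (Fin m → Bool) → ℂ)
    (A B : Fin (m + 1) → Bool) : ℂ :=
  ∑ a : Fin m → Bool, ∑ b : Fin m → Bool, ∑ d : Fin m → Bool,
    (∏ i : Fin (m + 1), W m i (A i) (B i) ((Fin.cons f a : Fin (m + 1) → Bool) i)
      ((Fin.snoc b f : Fin (m + 1) → Bool) i)
      ((Fin.cons f (Fin.snoc d f : Fin (m + 1) → Bool) : Fin (m + 2) → Bool) i.castSucc)
      ((Fin.cons f (Fin.snoc d f : Fin (m + 1) → Bool) : Fin (m + 2) → Bool) i.succ)) * F a b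

/-- Adding a diagonal, with state `f` at both ends, along the hypotenuse. -/
noncomputable def stepDiag (m : ℕ) (F : (Fin m → Bool) → (Fin m → Bool) → ℂ)
    (A B : Fin m → Bool) : ℂ :=
  ∑ a : Fin m → Bool, ∑ b : Fin m → Bool, ∑ d : Fin (m + 1) → Bool, ∑ e : Fin m → Bool,
    (if d 0 = f ∧ d (Fin.last m) = f then
      (∏ i : Fin m, Q i (d i.castSucc) (B i) (b i) (e i) *
        P (i.rev : ℕ) (e i) (a i) (A i) (d i.succ)) else 0) * F a b

/-- The weight of a node with the diagonal passing on the side of the right angle. -/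
noncomputable def nearWeight (k i : ℕ) (A B a b d d' : Bool) : ℂ :=
  ∑ a', ∑ b', ∑ e, P (k - i) d a a' e * R k i A B a' b' * Q i e b' b d'

/-- The weight of a node with the diagonal passing on the side of the hypotenuse. -/
noncomputable def farWeight (k i : ℕ) (A B a b d d' : Bool) : ℂ :=
  ∑ A', ∑ B', ∑ e, Q i d B B' e * R k i A' B' a b * P (k - i) e A' A d'

variable {f R W P Q}

/-- The diagonal passes its layer on the side of the right angle. Its outermost crossings, `P` at
node `0` and `Q` at node `m`, involve only the state `f` and have weight 1; the others form a
diagonal along the hypotenuse of the smaller triangle. -/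
lemma step20_eq_step6_stepDiag
    (hW : ∀ k i, W k i = nearWeight R P Q k i)
    (hP : ∀ u a e, P u f f a e = if a = f ∧ e = f then 1 else 0)
    (hQ : ∀ u e b, Q u e b f f = if e = f ∧ b = f then 1 else 0)
    (m : ℕ) (F : (Fin m → Bool) → (Fin m → Bool) → ℂ) :
    step20 f W m F = step6 f R m (stepDiag f P Q m F) := by
  ext A B
  simp only [step20, step6, stepDiag, hW, nearWeight, prod_sum_bool₃, Finset.sum_mul,
    Finset.mul_sum]
  rw [← sum_comm₆]
  -- At node `0` the diagonal and the first line both arrive in the state `f`, so by `hP` they also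
  -- leave in it.
  rw [sum_bool_cons, Finset.sum_eq_single_of_mem f (mem_univ _)]
  swap
  · intro t _ ht
    refine sum_eq_zero fun α _ => sum_eq_zero fun β _ => sum_eq_zero fun d _ =>
      sum_eq_zero fun e _ => sum_eq_zero fun a _ => sum_eq_zero fun b _ => ?_
    rw [Finset.prod_eq_zero (mem_univ 0), zero_mul]
    simp [hP, ht]
  refine sum_congr rfl fun α _ => ?_
  rw [sum_bool_snoc, Finset.sum_eq_single_of_mem f (mem_univ _)]
  swap
  · intro t _ ht
    refine sum_eq_zero fun β _ => sum_eq_zero fun d _ =>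
      sum_eq_zero fun e _ => sum_eq_zero fun a _ => sum_eq_zero fun b _ => ?_
    rw [Finset.prod_eq_zero (mem_univ (Fin.last m)), zero_mul]
    simp [hQ, ht]
  refine sum_congr rfl fun β _ => ?_
  rw [sum_comm₄]
  refine sum_congr rfl fun a _ => ?_
  refine sum_congr rfl fun b _ => ?_
  refine sum_congr rfl fun e _ => ?_
  refine sum_congr rfl fun d _ => ?_
  -- Peeling off the first `P` and the last `Q` pairs `Q` of node `i` with `P` of node `i + 1`, as
  -- in `stepDiag`.
  rw [prod_mul_distrib, prod_mul_distrib, Fin.prod_univ_succ (fun i : Fin (m + 1) => P _ _ _ _ _),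
    Fin.prod_univ_castSucc (fun i : Fin (m + 1) => Q _ _ _ _ _), prod_mul_distrib]
  simp only [Fin.cons_zero, Fin.snoc_last, Fin.castSucc_zero, Fin.cons_succ, Fin.snoc_castSucc,
    Fin.succ_castSucc, hP, hQ]
  by_cases h0 : e 0 = f <;> by_cases h1 : e (Fin.last m) = f <;> simp [h0, h1]
  ring

/-- A diagonal along the hypotenuse crosses both outer lines of each node of the outermost layer;
these two crossings and the node together make up the weight with the diagonal on the far side. -/
lemma stepDiag_step6
    (hW : ∀ k i, W k i = farWeight R P Q k i)
    (m : ℕ) (F : (Fin m → Bool) → (Fin m → Bool) → ℂ) :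
    stepDiag f P Q (m + 1) (step6 f R m F) = step20 f W m F := by
  ext A B
  simp only [step20, step6, stepDiag, hW, farWeight, prod_sum_bool₃, Finset.sum_mul,
    Finset.mul_sum]
  refine Eq.trans ?_ (sum_comm₆ _)
  refine sum_congr rfl fun α _ => ?_
  refine sum_congr rfl fun β _ => ?_
  rw [sum_bool_cons, Finset.sum_eq_single_of_mem f (mem_univ _)]
  swap
  · intro t _ ht
    simp [ht]
  rw [sum_bool_snoc, Finset.sum_eq_single_of_mem f (mem_univ _)]
  swap
  · intro t _ ht
    simp [ht, ← Fin.succ_last]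
  refine sum_congr rfl fun d _ => ?_
  refine sum_congr rfl fun e _ => ?_
  refine sum_congr rfl fun a _ => ?_
  refine sum_congr rfl fun b _ => ?_
  rw [if_pos (by simp [← Fin.succ_last]), ← mul_assoc, ← prod_mul_distrib]
  congr 1
  refine prod_congr rfl fun i _ => ?_
  rw [Fin.val_rev, show m + 1 - (↑i + 1) = m - i by omega]
  ring

lemma triZ_frozen_succ (w : ℕ → ℕ → Bool → Bool → Bool → Bool → Bool → Bool → ℂ) (f : Bool)
    (m : ℕ) : triZ (frozen f f w) (m + 1) = step20 f w m (triZ (frozen f f w) m) := by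
  ext A B
  rw [triZ, step20]
  rw [sum_bool_cons, Finset.sum_eq_single_of_mem f (mem_univ _)]
  swap
  · intro t _ ht
    refine sum_eq_zero fun a _ => sum_eq_zero fun b _ => sum_eq_zero fun d _ => ?_
    rw [Finset.prod_eq_zero (mem_univ 0), zero_mul]
    simp [frozen, ht]
  refine sum_congr rfl fun a _ => ?_
  rw [sum_bool_snoc, Finset.sum_eq_single_of_mem f (mem_univ _)]
  swap
  · intro t _ ht
    refine sum_eq_zero fun b _ => sum_eq_zero fun d _ => ?_
    rw [Finset.prod_eq_zero (mem_univ (Fin.last m)), zero_mul]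
    simp [frozen, ht]
  refine sum_congr rfl fun b _ => ?_
  rw [sum_bool_cons, Finset.sum_eq_single_of_mem f (mem_univ _)]
  swap
  · intro t _ ht
    refine sum_eq_zero fun d _ => ?_
    rw [Finset.prod_eq_zero (mem_univ 0), zero_mul]
    simp [frozen, ht]
  rw [sum_bool_snoc, Finset.sum_eq_single_of_mem f (mem_univ _)]
  swap
  · intro t _ ht
    refine sum_eq_zero fun d _ => ?_
    rw [Finset.prod_eq_zero (mem_univ (Fin.last m)), zero_mul]
    simp [frozen, ht]
  refine sum_congr rfl fun d _ => ?_
  simp only [Fin.cons_succ, Fin.snoc_castSucc]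
  congr 1
  refine prod_congr rfl fun i _ => ?_
  rw [frozen, if_pos]
  refine ⟨fun h => ?_, fun h => ?_⟩
  · obtain rfl : i = 0 := Fin.ext h
    simp
  · obtain rfl : i = Fin.last m := Fin.ext h
    simp

lemma triZ_frozen_succ' (f : Bool) (m : ℕ) :
    triZ (frozen f false fun k i A B a b d d' => if d = false ∧ d' = false then R k i A B a b else 0)
      (m + 1) = step6 f R m (triZ (frozen f false fun k i A B a b d d' =>
        if d = false ∧ d' = false then R k i A B a b else 0) m) := by
  ext A B
  rw [triZ, step6]
  rw [sum_bool_cons, Finset.sum_eq_single_of_mem f (mem_univ _)]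
  swap
  · intro t _ ht
    refine sum_eq_zero fun a _ => sum_eq_zero fun b _ => sum_eq_zero fun d _ => ?_
    rw [Finset.prod_eq_zero (mem_univ 0), zero_mul]
    simp [frozen, ht]
  refine sum_congr rfl fun a _ => ?_
  rw [sum_bool_snoc, Finset.sum_eq_single_of_mem f (mem_univ _)]
  swap
  · intro t _ ht
    refine sum_eq_zero fun b _ => sum_eq_zero fun d _ => ?_
    rw [Finset.prod_eq_zero (mem_univ (Fin.last m)), zero_mul]
    simp [frozen, ht]
  refine sum_congr rfl fun b _ => ?_
  -- Each diagonal edge touches a node of the layer, whose weight vanishes if the edge is occupied.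
  rw [Finset.sum_eq_single_of_mem (fun _ => false) (mem_univ _)]
  swap
  · intro d _ hd
    obtain ⟨j, hj⟩ : ∃ j, d j = true := by
      by_contra! h
      exact hd (funext fun j => by simpa using h j)
    rcases Fin.eq_zero_or_eq_succ j with rfl | ⟨i, rfl⟩
    · rw [Finset.prod_eq_zero (mem_univ 0), zero_mul]
      simp [frozen, hj]
    · rw [Finset.prod_eq_zero (mem_univ i), zero_mul]
      simp [frozen, hj]
  simp only [Fin.cons_succ, Fin.snoc_castSucc]
  congr 1
  refine prod_congr rfl fun i _ => ?_
  rw [frozen, if_pos]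
  · simp
  refine ⟨fun h => ?_, fun h => ?_⟩
  · obtain rfl : i = 0 := Fin.ext h
    simp
  · obtain rfl : i = Fin.last m := Fin.ext h
    simp

/-- Removal of all diagonals of a triangular region. -/
theorem triZ_remove_diagonals
    (hW : ∀ k i, W k i = nearWeight R P Q k i)
    (hW' : ∀ k i, W k i = farWeight R P Q k i)
    (hP : ∀ u a e, P u f f a e = if a = f ∧ e = f then 1 else 0)
    (hQ : ∀ u e b, Q u e b f f = if e = f ∧ b = f then 1 else 0) (m : ℕ) :
    triZ (frozen f f W) m = triZ (frozen f false fun k i A B a b d d' =>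
        if d = false ∧ d' = false then R k i A B a b else 0) m := by
  -- The induction must also carry that a further diagonal along the hypotenuse changes nothing.
  suffices h : triZ (frozen f f W) m = triZ (frozen f false fun k i A B a b d d' =>
        if d = false ∧ d' = false then R k i A B a b else 0) m ∧
      stepDiag f P Q m (triZ (frozen f f W) m) = triZ (frozen f f W) m from h.1
  induction m with
  | zero =>
    refine ⟨by ext; rfl, ?_⟩
    ext A B
    simp only [stepDiag, triZ]
    simp [sum_bool_cons, -sum_boole]
  | succ m ih =>
    have h1 : triZ (frozen f f W) (m + 1) = step6 f R m (triZ (frozen f f W) m) := by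
      rw [triZ_frozen_succ, step20_eq_step6_stepDiag hW hP hQ, ih.2]
    refine ⟨by rw [h1, triZ_frozen_succ', ih.1], ?_⟩
    -- The extra diagonal crosses the outermost layer: it is absorbed in far form, re-emitted in
    -- near form, and then lies on the smaller triangle, where the induction hypothesis removes it.
    rw [h1, stepDiag_step6 hW', step20_eq_step6_stepDiag hW hP hQ, ih.2]

end Triangle

/-! ### Local weights -/

/-- Six-vertex weight of the crossing of two lines with incoming states `i₁`, `i₂` and outgoing
states `o₁`, `o₂`. -/
noncomputable def crossing (a b c : ℂ) (i₁ i₂ o₁ o₂ : Bool) : ℂ :=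
  if i₁ = i₂ then (if o₁ = i₁ ∧ o₂ = i₁ then a else 0)
  else if o₁ = i₁ ∧ o₂ = i₂ then b else if o₁ = i₂ ∧ o₂ = i₁ then c else 0

/-- Weight of a node of the square lattice whose edges to the East, North, West and South have the
states `E`, `N`, `W`, `S`. -/
noncomputable def weight6 (a b c : ℂ) (E N W S : Bool) : ℂ := crossing a b c W N E S

/-- Crossing of a horizontal line by a diagonal. -/
noncomputable def crossingHD (d W W' e : Bool) : ℂ :=
  crossing 1 ((Real.sqrt 2 : ℂ) / 2) ((Real.sqrt 2 : ℂ) / 2) d W e W'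

/-- Crossing of a vertical line by a diagonal. -/
noncomputable def crossingVD (a b c : ℂ) (d N N' e : Bool) : ℂ :=
  crossing 1 ((Real.sqrt 2 : ℂ) - a / b) (c / b) d N e N'

/-- Weight of a node of the triangular lattice, with incoming diagonal in the state `d` and outgoing
diagonal in the state `e`. -/
noncomputable def weight20 (a b c : ℂ) (E N W S d e : Bool) : ℂ :=
  ∑ W', ∑ S', ∑ t, crossingHD d W W' t * weight6 a b c E N W' S' * crossingVD a b c t S' S e

lemma sqrt_two_sq : (Real.sqrt 2 : ℂ) ^ 2 = 2 := by
  rw [← Complex.ofReal_pow, Real.sq_sqrt (by norm_num)]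
  norm_num

lemma sqrt_two_ne_zero : (Real.sqrt 2 : ℂ) ≠ 0 := by
  intro h
  have := sqrt_two_sq
  rw [h] at this
  norm_num at this

/-- The Yang–Baxter equation. -/
lemma weight20_eq {a b c : ℂ} (hb : b ≠ 0)
    (hc : c ^ 2 = a ^ 2 + b ^ 2 - (Real.sqrt 2 : ℂ) * a * b) (E N W S d e : Bool) :
    weight20 a b c E N W S d e =
      ∑ E', ∑ N', ∑ t, crossingVD a b c d N N' t * weight6 a b c E' N' W S *
        crossingHD t E' E e := by
  have h2 := sqrt_two_sq
  unfold weight20 crossingHD crossingVD weight6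
  generalize (Real.sqrt 2 : ℂ) = r at *
  -- After clearing denominators each of the 64 cases follows from `r² = 2` or from the relation
  -- between `a, b, c`.
  cases E <;> cases N <;> cases W <;> cases S <;> cases d <;> cases e <;>
    simp [crossing] <;> field_simp <;>
    first
      | ring1
      | linear_combination c * b * h2
      | linear_combination -(c * b) * h2
      | linear_combination r * hc
      | linear_combination -r * hc

/-- The states of the incoming edges of a node and those of its outgoing edges have the same sum. -/
def Ice (E N W S d e : Bool) : Prop :=
  W.toNat + N.toNat + d.toNat = E.toNat + S.toNat + e.toNat

instance (E N W S d e : Bool) : Decidable (Ice E N W S d e) := inferInstanceAs (Decidable (_ = _))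

lemma weight20_eq_zero (a b c : ℂ) {E N W S d e : Bool} (h : ¬ Ice E N W S d e) :
    weight20 a b c E N W S d e = 0 := by
  revert h
  cases E <;> cases N <;> cases W <;> cases S <;> cases d <;> cases e <;>
    simp [weight20, crossingHD, crossingVD, weight6, crossing, Ice]

lemma weight6_eq_zero (a b c : ℂ) {E N W S : Bool} (h : ¬ Ice E N W S false false) :
    weight6 a b c E N W S = 0 := by
  revert h
  cases E <;> cases N <;> cases W <;> cases S <;> simp [weight6, crossing, Ice]

/-- Here `√2 - 1/√2 = 1/√2`, so both diagonal crossings have the weights `1, 1/√2, 1/√2`; the sum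
over internal states is then 1 in each of the twenty ice states. -/
lemma weight20_one {E N W S d e : Bool} (h : Ice E N W S d e) :
    weight20 1 (Real.sqrt 2 : ℂ) 1 E N W S d e = 1 := by
  revert h
  have h2 := sqrt_two_sq
  have h0 := sqrt_two_ne_zero
  unfold weight20 crossingHD crossingVD weight6
  generalize (Real.sqrt 2 : ℂ) = r at *
  cases E <;> cases N <;> cases W <;> cases S <;> cases d <;> cases e <;>
    simp [crossing, Ice] <;> field_simp <;>
    first
      | done
      | linear_combination h2

/-! ### Weights of the node types occurring in the last column -/

section LastColumn

variable (a : ℂ) {b : ℂ} (c : ℂ)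

lemma weight20_empty : weight20 a b c false false false false false false = a := by
  simp [weight20, crossingHD, crossingVD, weight6, crossing]

lemma weight20_turn (hb : b ≠ 0) (W d : Bool) (h : W = !d) :
    weight20 a b c false false W true d false = c := by
  have h2 := sqrt_two_sq
  have h0 := sqrt_two_ne_zero
  subst h
  unfold weight20 crossingHD crossingVD weight6
  generalize (Real.sqrt 2 : ℂ) = r at *
  cases d <;> simp [crossing] <;> field_simp <;>
    first
      | ring1
      | linear_combination c * b * h2

/-- For `a = 1`, `b = √2σ` this is `2σ - 1`, the future `τ`. -/
lemma weight20_straight (hb : b ≠ 0) :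
    weight20 a b c false true false true false false = (Real.sqrt 2 : ℂ) * b - a := by
  simp [weight20, crossingHD, crossingVD, weight6, crossing]
  field_simp

lemma weight20_corner_turn : weight20 a b c false false true true true true = c := by
  simp [weight20, crossingHD, crossingVD, weight6, crossing]

/-- The bottom node of the last column is special because its outgoing boundary diagonal is
occupied. For `b = √2σ` this weight is `σ`. -/
lemma weight20_corner_straight (hb : b ≠ 0) (W d : Bool) (h : W = !d) :
    weight20 a b c false true W true d true = b / (Real.sqrt 2 : ℂ) := by
  have h2 := sqrt_two_sq
  have h0 := sqrt_two_ne_zero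
  subst h
  unfold weight20 crossingHD crossingVD weight6
  generalize (Real.sqrt 2 : ℂ) = r at *
  cases d <;> simp [crossing] <;> field_simp <;>
    first
      | ring1
      | linear_combination h2

end LastColumn

/-- A weight equal to `w` with parameters `a, b, c` in the last column and with parameters
`1, √2, 1` elsewhere. -/
noncomputable def colParam {α : Type*} (w : ℂ → ℂ → ℂ → α) (a b c : ℂ) (last : Bool) : α :=
  if last then w a b c else w 1 (Real.sqrt 2 : ℂ) 1

lemma crossingHD_false (a e : Bool) :
    (crossingHD a e false false = if a = false ∧ e = false then 1 else 0) ∧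
      (crossingHD true true a e = if a = true ∧ e = true then 1 else 0) := by
  cases a <;> cases e <;> simp [crossingHD, crossing]

lemma colParam_crossingVD (a b c : ℂ) (l : Bool) (t e : Bool) :
    (colParam crossingVD a b c l t e true true = if t = true ∧ e = true then 1 else 0) ∧
      (colParam crossingVD a b c l false false t e = if t = false ∧ e = false then 1 else 0) := by
  cases l <;> cases t <;> cases e <;> simp [colParam, crossingVD, crossing]

/-- Only the parameters of the last vertical line change; horizontal-diagonal crossings stay the
same, so the Yang–Baxter equation holds column by column. -/
lemma colParam_weight20_eq {a b c : ℂ} (hb : b ≠ 0)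
    (hc : c ^ 2 = a ^ 2 + b ^ 2 - (Real.sqrt 2 : ℂ) * a * b) (l E N W S d e : Bool) :
    colParam weight20 a b c l E N W S d e =
      ∑ E', ∑ N', ∑ t, colParam crossingVD a b c l d N N' t *
        colParam weight6 a b c l E' N' W S * crossingHD t E' E e := by
  cases l
  · simp only [colParam, Bool.false_eq_true, if_false]
    exact weight20_eq sqrt_two_ne_zero (by ring) ..
  · simp only [colParam, if_true]
    exact weight20_eq hb hc ..

lemma colParam_weight20_eq' (a b c : ℂ) (l E N W S d e : Bool) :
    colParam weight20 a b c l E N W S d e =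
      ∑ W', ∑ S', ∑ t, crossingHD d W W' t * colParam weight6 a b c l E N W' S' *
        colParam crossingVD a b c l t S' S e := by
  cases l <;> rfl

/-- Here the first lines are horizontal and the second ones vertical. A second line keeps its index
`i` in all layers, and it is column `i + 1`. -/
theorem triZ_lower {a b c : ℂ} (hb : b ≠ 0)
    (hc : c ^ 2 = a ^ 2 + b ^ 2 - (Real.sqrt 2 : ℂ) * a * b) (n m : ℕ) :
    triZ (frozen true true fun _ i E N W S d e =>
        colParam weight20 a b c (decide (i + 1 = n)) E N W S d e) m =
      triZ (frozen true false fun _ i E N W S d e =>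
        if d = false ∧ e = false then colParam weight6 a b c (decide (i + 1 = n)) E N W S else 0)
        m := by
  refine triZ_remove_diagonals
    (R := fun _ i => colParam weight6 a b c (decide (i + 1 = n)))
    (P := fun _ => crossingHD) (Q := fun i => colParam crossingVD a b c (decide (i + 1 = n)))
    ?_ ?_ ?_ ?_ m
  · intro k i
    ext E N W S d e
    rw [colParam_weight20_eq', nearWeight]
  · intro k i
    ext E N W S d e
    rw [colParam_weight20_eq hb hc, farWeight]
  · exact fun _ a e => (crossingHD_false a e).2
  · exact fun _ e t => (colParam_crossingVD ..).1

/-- This triangle is turned by 180 degrees, which exchanges near and far sides. The vertical lines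
are now the first lines; their invariant label `k - i` counts columns from the right, `0` being the
last. -/
theorem triZ_upper {a b c : ℂ} (hb : b ≠ 0)
    (hc : c ^ 2 = a ^ 2 + b ^ 2 - (Real.sqrt 2 : ℂ) * a * b) (m : ℕ) :
    triZ (frozen false false fun k i S W N E d e =>
        colParam weight20 a b c (decide (k - i = 0)) E N W S d e) m =
      triZ (frozen false false fun k i S W N E d e =>
        if d = false ∧ e = false then colParam weight6 a b c (decide (k - i = 0)) E N W S else 0)
        m := by
  refine triZ_remove_diagonals
    (R := fun k i S W N E => colParam weight6 a b c (decide (k - i = 0)) E N W S)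
    (P := fun u => colParam crossingVD a b c (decide (u = 0))) (Q := fun _ => crossingHD)
    ?_ ?_ ?_ ?_ m
  · intro k i
    ext S W N E d e
    rw [colParam_weight20_eq hb hc, nearWeight, sum_comm]
  · intro k i
    ext S W N E d e
    rw [colParam_weight20_eq', farWeight, sum_comm]
  · exact fun _ a e => (colParam_crossingVD ..).2
  · exact fun _ e t => (crossingHD_false e t).1

/-! ### Summation over states of sets of edges -/

section Marginal

variable {ε : Type*}

/-- `g` does not depend on the states of the edges of `T`. -/
def Free (T : Finset ε) (g : (ε → Bool) → ℂ) : Prop :=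
  ∀ χ χ' : ε → Bool, (∀ e, e ∉ T → χ e = χ' e) → g χ = g χ'

lemma Free.mono {S T : Finset ε} {g : (ε → Bool) → ℂ} (hg : Free T g) (h : S ⊆ T) : Free S g :=
  fun χ χ' H => hg χ χ' fun e he => H e fun h' => he (h h')

lemma free_prod {ι : Type*} {s : Finset ι} {T : Finset ε} {g : ι → (ε → Bool) → ℂ}
    (hg : ∀ i ∈ s, Free T (g i)) : Free T (∏ i ∈ s, g i) := by
  intro χ χ' H
  simp only [Finset.prod_apply]
  exact prod_congr rfl fun i hi => hg i hi _ _ H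

variable [DecidableEq ε]

/-- The states `χ`, replaced on `T` by the indicator of `ω`. -/
def overlay (T ω : Finset ε) (χ : ε → Bool) (e : ε) : Bool :=
  if e ∈ T then decide (e ∈ ω) else χ e

/-- Sum of `g` over all states of the edges of `T`. -/
noncomputable def marginal (T : Finset ε) (g : (ε → Bool) → ℂ) (χ : ε → Bool) : ℂ :=
  ∑ ω ∈ T.powerset, g (overlay T ω χ)

lemma marginal_empty (g : (ε → Bool) → ℂ) : marginal ∅ g = g := by
  ext χ
  simp only [marginal, powerset_empty, sum_singleton]
  congr 1

lemma marginal_union {S T : Finset ε} (h : Disjoint S T) (g : (ε → Bool) → ℂ) :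
    marginal (S ∪ T) g = marginal S (marginal T g) := by
  ext χ
  simp only [marginal, ← sum_product']
  symm
  refine sum_bij (fun p _ => p.1 ∪ p.2) ?_ ?_ ?_ ?_
  · rintro ⟨α, β⟩ hp
    simp only [mem_product, mem_powerset] at hp ⊢
    exact union_subset_union hp.1 hp.2
  · rintro ⟨α, β⟩ hp ⟨α', β'⟩ hp' heq
    simp only [mem_product, mem_powerset] at hp hp' heq
    rw [Finset.disjoint_left] at h
    simp only [Finset.ext_iff, mem_union] at heq
    simp only [Prod.mk.injEq, Finset.ext_iff]
    refine ⟨fun e => ?_, fun e => ?_⟩ <;> have := heq e <;> have := @h e <;> have := @hp.1 e <;>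
      have := @hp.2 e <;> have := @hp'.1 e <;> have := @hp'.2 e <;> tauto
  · intro γ hγ
    refine ⟨(γ ∩ S, γ ∩ T), ?_, ?_⟩
    · simp [inter_subset_right]
    · rw [← inter_union_distrib_left, inter_eq_left]
      exact mem_powerset.mp hγ
  · rintro ⟨α, β⟩ hp
    simp only [mem_product, mem_powerset] at hp
    congr 1
    ext e
    have := @hp.1 e
    have := @hp.2 e
    have := fun h1 : e ∈ S => Finset.disjoint_left.mp h h1
    by_cases h1 : e ∈ S <;> by_cases h2 : e ∈ T <;> simp_all [overlay]

lemma marginal_mul_left {T : Finset ε} {g : (ε → Bool) → ℂ} (hg : Free T g)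
    (g' : (ε → Bool) → ℂ) : marginal T (g * g') = g * marginal T g' := by
  ext χ
  simp only [marginal, Pi.mul_apply, mul_sum]
  refine sum_congr rfl fun ω _ => ?_
  rw [hg _ χ fun e he => ?_]
  simp [overlay, he]

/-- Links sums over subsets of edges with the sums over Boolean vectors in `triZ`. -/
lemma marginal_image {κ : Type*} [Fintype κ] [DecidableEq κ] {φ : κ → ε}
    (hφ : Function.Injective φ) (g : (ε → Bool) → ℂ) (χ : ε → Bool) :
    marginal (univ.image φ) g χ = ∑ x : κ → Bool, g (Function.extend φ x χ) := by
  rw [marginal]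
  refine sum_bij' (fun ω _ i => decide (φ i ∈ ω)) (fun x _ => (univ.filter fun i => x i).image φ)
    ?_ ?_ ?_ ?_ ?_
  · simp
  · intro x _
    simpa using image_subset_image (filter_subset _ _)
  · intro ω hω
    ext e
    simp only [mem_powerset] at hω
    simp only [decide_eq_true_eq, mem_image, mem_filter, mem_univ, true_and]
    constructor
    · rintro ⟨i, hi, rfl⟩
      exact hi
    · intro he
      obtain ⟨i, -, rfl⟩ := mem_image.mp (hω he)
      exact ⟨i, he, rfl⟩
  · intro x _
    ext i
    simp [hφ.eq_iff]
  · intro ω hω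
    congr 1
    ext e
    by_cases he : ∃ i, φ i = e
    · obtain ⟨i, rfl⟩ := he
      rw [hφ.extend_apply]
      simp [overlay]
    · rw [Function.extend_apply' _ _ _ he]
      push Not at he
      simp [overlay, he]

end Marginal

/-! ### Triangular regions of the lattice -/

section TriangleEdges

variable (E : Dir × ℕ × ℕ → Edge)

/-- The edges of the `k`-th layer of a triangle: two towards the right angle at each node and those
along the layer. -/
def layerEdges (k : ℕ) : Finset Edge :=
  univ.image (Sum.elim (fun i : Fin (k + 1) => E (.horizontal, k, i))
    (Sum.elim (fun i : Fin (k + 1) => E (.vertical, k, i))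
      fun i : Fin (k + 2) => E (.diagonal, k, i)))

/-- The edges of the layers `0, …, m - 1` of a triangle. -/
def triEdges : ℕ → Finset Edge
  | 0 => ∅
  | m + 1 => layerEdges E m ∪ triEdges m

/-- Labels of the edges of the layers `k ≤ M`. -/
def triLabels (M : ℕ) : Set (Dir × ℕ × ℕ) :=
  {p | p.2.1 ≤ M ∧ p.2.2 ≤ p.2.1 + if p.1 = .diagonal then 1 else 0}

/-- The weight of node `i` of layer `k`. -/
def triNode (w : ℕ → ℕ → Bool → Bool → Bool → Bool → Bool → Bool → ℂ) (k i : ℕ)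
    (χ : Edge → Bool) : ℂ :=
  w k i (χ (E (.horizontal, k + 1, i + 1))) (χ (E (.vertical, k + 1, i)))
    (χ (E (.horizontal, k, i))) (χ (E (.vertical, k, i))) (χ (E (.diagonal, k, i)))
    (χ (E (.diagonal, k, i + 1)))

variable {E}

lemma horizontal_mem_triLabels {M k i : ℕ} : (Dir.horizontal, k, i) ∈ triLabels M ↔
    k ≤ M ∧ i ≤ k := by simp [triLabels]

lemma vertical_mem_triLabels {M k i : ℕ} : (Dir.vertical, k, i) ∈ triLabels M ↔
    k ≤ M ∧ i ≤ k := by simp [triLabels]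

lemma diagonal_mem_triLabels {M k i : ℕ} : (Dir.diagonal, k, i) ∈ triLabels M ↔
    k ≤ M ∧ i ≤ k + 1 := by simp [triLabels]

lemma mem_layerEdges_iff {k : ℕ} {e : Edge} :
    e ∈ layerEdges E k ↔ ∃ p ∈ triLabels k, p.2.1 = k ∧ E p = e := by
  simp only [layerEdges, mem_image, mem_univ, true_and]
  constructor
  · rintro ⟨i | i | i, rfl⟩
    · exact ⟨_, horizontal_mem_triLabels.2 ⟨le_rfl, by omega⟩, rfl, rfl⟩
    · exact ⟨_, vertical_mem_triLabels.2 ⟨le_rfl, by omega⟩, rfl, rfl⟩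
    · exact ⟨_, diagonal_mem_triLabels.2 ⟨le_rfl, by omega⟩, rfl, rfl⟩
  · rintro ⟨⟨_ | _ | _, l, i⟩, hp, rfl, rfl⟩
    · have := (horizontal_mem_triLabels.1 hp).2
      exact ⟨.inl ⟨i, by simp only; omega⟩, rfl⟩
    · have := (diagonal_mem_triLabels.1 hp).2
      exact ⟨.inr (.inr ⟨i, by simp only; omega⟩), rfl⟩
    · have := (vertical_mem_triLabels.1 hp).2
      exact ⟨.inr (.inl ⟨i, by simp only; omega⟩), rfl⟩

lemma triLabels_mono {k M : ℕ} (h : k ≤ M) : triLabels k ⊆ triLabels M :=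
  fun _ hp => ⟨hp.1.trans h, hp.2⟩

lemma mem_layerEdges {M k : ℕ} (hE : Set.InjOn E (triLabels M)) (hk : k ≤ M) {p : Dir × ℕ × ℕ}
    (hp : p ∈ triLabels M) : E p ∈ layerEdges E k ↔ p.2.1 = k := by
  rw [mem_layerEdges_iff]
  constructor
  · rintro ⟨q, hq, hqk, hqp⟩
    rw [← hE (triLabels_mono hk hq) hp hqp, hqk]
  · rintro rfl
    exact ⟨p, ⟨le_rfl, hp.2⟩, rfl, rfl⟩

lemma mem_triEdges_iff {m : ℕ} {e : Edge} :
    e ∈ triEdges E m ↔ ∃ p ∈ triLabels m, p.2.1 < m ∧ E p = e := by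
  induction m with
  | zero => simp [triEdges]
  | succ m ih =>
    rw [triEdges, mem_union, ih, mem_layerEdges_iff]
    constructor
    · rintro (⟨p, hp, h, h'⟩ | ⟨p, hp, h, h'⟩)
      · exact ⟨p, triLabels_mono m.le_succ hp, by omega, h'⟩
      · exact ⟨p, triLabels_mono m.le_succ hp, by omega, h'⟩
    · rintro ⟨p, hp, h, h'⟩
      have hp' : p ∈ triLabels m := ⟨by omega, hp.2⟩
      rcases (Nat.lt_succ_iff.1 h).lt_or_eq with h1 | h1
      · exact .inr ⟨p, hp', h1, h'⟩
      · exact .inl ⟨p, hp', h1, h'⟩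

lemma mem_triEdges {M m : ℕ} (hE : Set.InjOn E (triLabels M)) (hm : m ≤ M) {p : Dir × ℕ × ℕ}
    (hp : p ∈ triLabels M) : E p ∈ triEdges E m ↔ p.2.1 < m := by
  rw [mem_triEdges_iff]
  constructor
  · rintro ⟨q, hq, hqk, hqp⟩
    rwa [← hE (triLabels_mono hm hq) hp hqp]
  · exact fun h => ⟨p, ⟨h.le, hp.2⟩, h, rfl⟩

lemma free_triNode {M k i : ℕ} (T : Finset Edge)
    (hT : ∀ p ∈ triLabels M, k ≤ p.2.1 → E p ∉ T) (hk : k + 1 ≤ M) (hi : i ≤ k)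
    (w : ℕ → ℕ → Bool → Bool → Bool → Bool → Bool → Bool → ℂ) :
    Free T (triNode E w k i) := by
  intro χ χ' H
  unfold triNode
  rw [H _ (hT (.horizontal, k + 1, i + 1) (horizontal_mem_triLabels.2 (by omega)) (by simp)),
    H _ (hT (.vertical, k + 1, i) (vertical_mem_triLabels.2 (by omega)) (by simp)),
    H _ (hT (.horizontal, k, i) (horizontal_mem_triLabels.2 (by omega)) (by simp)),
    H _ (hT (.vertical, k, i) (vertical_mem_triLabels.2 (by omega)) (by simp)),
    H _ (hT (.diagonal, k, i) (diagonal_mem_triLabels.2 (by omega)) (by simp)),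
    H _ (hT (.diagonal, k, i + 1) (diagonal_mem_triLabels.2 (by omega)) (by simp))]

/-- Nodes of the outermost layer do not touch edges of inner layers, so the inner sum can be carried
out first. The edges of layer `m` across the hypotenuse are not summed and enter as boundary data.
-/
theorem marginal_triEdges {M : ℕ} (hE : Set.InjOn E (triLabels M))
    (w : ℕ → ℕ → Bool → Bool → Bool → Bool → Bool → Bool → ℂ) {m : ℕ} (hm : m ≤ M)
    (χ : Edge → Bool) :
    marginal (triEdges E m) (∏ k ∈ range m, ∏ i ∈ range (k + 1), triNode E w k i) χ =
      triZ w m (fun i => χ (E (.horizontal, m, i + 1))) (fun i => χ (E (.vertical, m, i))) := by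
  induction m generalizing χ with
  | zero => simp [triEdges, marginal_empty, triZ]
  | succ m ih =>
    have hdisj : Disjoint (layerEdges E m) (triEdges E m) := by
      rw [Finset.disjoint_left]
      intro e he
      obtain ⟨p, hp, h, rfl⟩ := mem_layerEdges_iff.1 he
      rw [mem_triEdges hE (by omega) (triLabels_mono (by omega) hp)]
      omega
    have hfree : Free (triEdges E m) (∏ i ∈ range (m + 1), triNode E w m i) := by
      refine free_prod fun i hi => ?_
      refine free_triNode _ (fun p hp h => ?_) hm (by simpa [Nat.lt_succ_iff] using hi) w
      rw [mem_triEdges hE (by omega) hp]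
      omega
    rw [triEdges, marginal_union hdisj, prod_range_succ, mul_comm, marginal_mul_left hfree]
    have hφ : Function.Injective (Sum.elim (fun i : Fin (m + 1) => E (.horizontal, m, i))
        (Sum.elim (fun i : Fin (m + 1) => E (.vertical, m, i))
        fun i : Fin (m + 2) => E (.diagonal, m, i))) := by
      have h1 (i : Fin (m + 1)) : (Dir.horizontal, m, (i : ℕ)) ∈ triLabels M :=
        horizontal_mem_triLabels.2 (by omega)
      have h2 (i : Fin (m + 1)) : (Dir.vertical, m, (i : ℕ)) ∈ triLabels M :=
        vertical_mem_triLabels.2 (by omega)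
      have h3 (i : Fin (m + 2)) : (Dir.diagonal, m, (i : ℕ)) ∈ triLabels M :=
        diagonal_mem_triLabels.2 (by omega)
      rintro (i | i | i) (j | j | j) h <;> simp only [Sum.elim_inl, Sum.elim_inr] at h
      · simpa [Fin.ext_iff] using hE (h1 _) (h1 _) h
      · simpa using hE (h1 _) (h2 _) h
      · simpa using hE (h1 _) (h3 _) h
      · simpa using hE (h2 _) (h1 _) h
      · simpa [Fin.ext_iff] using hE (h2 _) (h2 _) h
      · simpa using hE (h2 _) (h3 _) h
      · simpa using hE (h3 _) (h1 _) h
      · simpa using hE (h3 _) (h2 _) h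
      · simpa [Fin.ext_iff] using hE (h3 _) (h3 _) h
    rw [layerEdges, marginal_image hφ, triZ]
    rw [← (Equiv.sumArrowEquivProdArrow _ _ _).symm.sum_comp, Fintype.sum_prod_type]
    refine sum_congr rfl fun a _ => ?_
    rw [← (Equiv.sumArrowEquivProdArrow _ _ _).symm.sum_comp, Fintype.sum_prod_type]
    refine sum_congr rfl fun b _ => ?_
    refine sum_congr rfl fun d _ => ?_
    set x := (Equiv.sumArrowEquivProdArrow (Fin (m + 1)) (Fin (m + 1) ⊕ Fin (m + 2)) Bool).symm
      (a, (Equiv.sumArrowEquivProdArrow (Fin (m + 1)) (Fin (m + 2)) Bool).symm (b, d)) with hx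
    set φ := (Sum.elim (fun i : Fin (m + 1) => E (.horizontal, m, i))
        (Sum.elim (fun i : Fin (m + 1) => E (.vertical, m, i))
        fun i : Fin (m + 2) => E (.diagonal, m, i))) with hφ'
    have e1 (i : Fin (m + 1)) : Function.extend φ x χ (E (.horizontal, m, i)) = a i :=
      hφ.extend_apply x χ (.inl i)
    have e2 (i : Fin (m + 1)) : Function.extend φ x χ (E (.vertical, m, i)) = b i :=
      hφ.extend_apply x χ (.inr (.inl i))
    have e3 (i : Fin (m + 2)) : Function.extend φ x χ (E (.diagonal, m, i)) = d i :=
      hφ.extend_apply x χ (.inr (.inr i))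
    have e4 (p : Dir × ℕ × ℕ) (hp : p ∈ triLabels M) (h : p.2.1 = m + 1) :
        Function.extend φ x χ (E p) = χ (E p) := by
      refine Function.extend_apply' _ _ _ fun ⟨t, ht⟩ => ?_
      have : E p ∈ layerEdges E m := by
        rw [layerEdges, mem_image]
        exact ⟨t, mem_univ _, ht⟩
      rw [mem_layerEdges hE (by omega) hp] at this
      omega
    rw [Pi.mul_apply, ih (by omega), Finset.prod_apply,
      ← Fin.prod_univ_eq_prod_range (fun i => triNode E w m i _)]
    congr 1
    · refine prod_congr rfl fun i _ => ?_
      unfold triNode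
      have e5 := e3 i.castSucc
      have e6 := e3 i.succ
      rw [Fin.val_castSucc] at e5
      rw [Fin.val_succ] at e6
      rw [e1, e2, e5, e6, e4 _ (horizontal_mem_triLabels.2 (by omega)) rfl,
        e4 _ (vertical_mem_triLabels.2 (by omega)) rfl]
    · congr 1
      · ext i
        have := e1 i.succ
        rwa [Fin.val_succ] at this
      · ext i
        have := e2 i.castSucc
        rwa [Fin.val_castSucc] at this

end TriangleEdges

/-! ### Decomposition of the square into two triangles -/

/-- Edges of the triangle below the antidiagonal, in terms of layers. -/
def lowerEdge : Dir × ℕ × ℕ → Edge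
  | (.horizontal, k, i) => (.horizontal, i, k + 1 - i)
  | (.vertical, k, i) => (.vertical, i + 1, k - i)
  | (.diagonal, k, i) => (.diagonal, i, k + 1 - i)

/-- Edges of the triangle above the antidiagonal, in terms of layers. -/
def upperEdge (n : ℕ) : Dir × ℕ × ℕ → Edge
  | (.horizontal, k, i) => (.vertical, n - k + i, n - i)
  | (.vertical, k, i) => (.horizontal, n - k + i, n - i)
  | (.diagonal, k, i) => (.diagonal, n - k + i - 1, n - i)

lemma injOn_lowerEdge (M : ℕ) : Set.InjOn lowerEdge (triLabels M) := by
  rintro ⟨_ | _ | _, k, i⟩ hp ⟨_ | _ | _, l, j⟩ hq h <;>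
    simp [triLabels, lowerEdge] at hp hq h ⊢ <;> omega

/-- Layers `k ≤ n - 1` have `n - k ≥ 1`, so the truncated subtraction in the abscissa of a diagonal
is harmless. -/
lemma injOn_upperEdge {n : ℕ} (hn : 1 ≤ n) : Set.InjOn (upperEdge n) (triLabels (n - 1)) := by
  rintro ⟨_ | _ | _, k, i⟩ hp ⟨_ | _ | _, l, j⟩ hq h <;>
    simp [triLabels, upperEdge] at hp hq h ⊢ <;> omega

lemma mem_lower {n : ℕ} {s : Dir} {x y : ℕ} : (s, x, y) ∈ triEdges lowerEdge n ↔
    x + y ≤ n ∧ (s = .horizontal → 1 ≤ y) ∧ (s = .vertical → 1 ≤ x) ∧ 1 ≤ x + y := by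
  rw [mem_triEdges_iff]
  constructor
  · rintro ⟨⟨_ | _ | _, k, i⟩, hp, hk, h⟩ <;> simp [triLabels, lowerEdge] at hp hk h <;>
      obtain ⟨rfl, rfl, rfl⟩ := h <;> simp <;> omega
  · rintro ⟨h1, h2, h3, h4⟩
    cases s
    · have := h2 rfl
      refine ⟨(.horizontal, x + y - 1, x), ?_, ?_, ?_⟩ <;> simp [triLabels, lowerEdge] <;> omega
    · refine ⟨(.diagonal, x + y - 1, x), ?_, ?_, ?_⟩ <;> simp [triLabels, lowerEdge] <;> omega
    · have := h3 rfl
      refine ⟨(.vertical, x + y - 1, x - 1), ?_, ?_, ?_⟩ <;> simp [triLabels, lowerEdge] <;> omega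

lemma mem_upper {n : ℕ} (hn : 1 ≤ n) {s : Dir} {x y : ℕ} :
    (s, x, y) ∈ triEdges (upperEdge n) (n - 1) ↔
      x ≤ n ∧ y ≤ n ∧ (if s = .diagonal then n + 1 ≤ x + y ∧ x + y + 1 ≤ 2 * n
        else n + 2 ≤ x + y) := by
  rw [mem_triEdges_iff]
  constructor
  · rintro ⟨⟨_ | _ | _, k, i⟩, hp, hk, h⟩ <;> simp [triLabels, upperEdge] at hp hk h <;>
      obtain ⟨rfl, rfl, rfl⟩ := h <;> simp <;> omega
  · rintro ⟨h1, h2, h3⟩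
    cases s <;> simp at h3
    · refine ⟨(.vertical, 2 * n - x - y, n - y), ?_, ?_, ?_⟩ <;>
        simp [triLabels, upperEdge] <;> omega
    · refine ⟨(.diagonal, 2 * n - x - y - 1, n - y), ?_, ?_, ?_⟩ <;>
        simp [triLabels, upperEdge] <;> omega
    · refine ⟨(.horizontal, 2 * n - x - y, n - y), ?_, ?_, ?_⟩ <;>
        simp [triLabels, upperEdge] <;> omega

/-- The edges between the two triangles. -/
def midEdges (n : ℕ) : Finset Edge :=
  (edges dirs20V n).filter fun e => e.1 ≠ .diagonal ∧ e.2.1 + e.2.2 = n + 1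

lemma mem_edges20V {n : ℕ} {s : Dir} {x y : ℕ} : (s, x, y) ∈ edges dirs20V n ↔
    x ≤ n ∧ y ≤ n ∧ (s = .horizontal → 1 ≤ y) ∧ (s = .vertical → 1 ≤ x) ∧
      1 ≤ x + y ∧ (s = .diagonal → x + y + 1 ≤ 2 * n) ∧ 1 ≤ n := by
  cases s <;> simp [edges, dirs20V, grid, src, tgt] <;> omega

lemma mem_midEdges {n : ℕ} {s : Dir} {x y : ℕ} : (s, x, y) ∈ midEdges n ↔
    s ≠ .diagonal ∧ x + y = n + 1 ∧ x ≤ n ∧ y ≤ n := by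
  rw [midEdges, mem_filter, mem_edges20V]
  cases s <;> simp <;> omega

lemma edges20V_eq {n : ℕ} (hn : 1 ≤ n) : edges dirs20V n =
    midEdges n ∪ (triEdges (upperEdge n) (n - 1) ∪ triEdges lowerEdge n) := by
  ext ⟨s, x, y⟩
  rw [mem_union, mem_union, mem_edges20V, mem_midEdges, mem_lower, mem_upper hn]
  cases s <;> simp <;> omega

/-- The antidiagonal `x + y = n + 1` belongs to the lower triangle, which therefore has `n` layers
and the upper one only `n - 1`. -/
lemma grid_prod {n : ℕ} (hn : 1 ≤ n) {M : Type*} [CommMonoid M] (g : ℕ × ℕ → M) :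
    ∏ p ∈ grid n, g p = (∏ k ∈ range (n - 1), ∏ i ∈ range (k + 1), g (n - k + i, n - i)) *
      ∏ k ∈ range n, ∏ i ∈ range (k + 1), g (i + 1, k + 1 - i) := by
  rw [← prod_filter_mul_prod_filter_not (grid n) (fun p => n + 2 ≤ p.1 + p.2), prod_sigma',
    prod_sigma']
  congr 1
  · refine prod_bij' (fun p _ => ⟨2 * n - p.1 - p.2, n - p.2⟩) (fun q _ => (n - q.1 + q.2, n - q.2))
      ?_ ?_ ?_ ?_ ?_
    · rintro ⟨x, y⟩ h
      simp [grid] at h ⊢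
      omega
    · rintro ⟨k, i⟩ h
      simp [grid] at h ⊢
      omega
    · rintro ⟨x, y⟩ h
      simp [grid] at h ⊢
      omega
    · rintro ⟨k, i⟩ h
      simp at h ⊢
      omega
    · rintro ⟨x, y⟩ h
      simp [grid] at h
      congr 1
      simp
      omega
  · refine prod_bij' (fun p _ => ⟨p.1 + p.2 - 2, p.1 - 1⟩) (fun q _ => (q.2 + 1, q.1 + 1 - q.2))
      ?_ ?_ ?_ ?_ ?_
    · rintro ⟨x, y⟩ h
      simp [grid] at h ⊢
      omega
    · rintro ⟨k, i⟩ h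
      simp [grid] at h ⊢
      omega
    · rintro ⟨x, y⟩ h
      simp [grid] at h ⊢
      omega
    · rintro ⟨k, i⟩ h
      simp at h ⊢
      omega
    · rintro ⟨x, y⟩ h
      simp [grid] at h
      congr 1
      simp
      omega

/-- The function `w` of the states of the six edges at the node `p`. -/
def atNode {α : Type*} (w : Bool → Bool → Bool → Bool → Bool → Bool → α) (p : ℕ × ℕ)
    (χ : Edge → Bool) : α :=
  w (χ (.horizontal, p.1, p.2)) (χ (.vertical, p.1, p.2)) (χ (.horizontal, p.1 - 1, p.2))
    (χ (.vertical, p.1, p.2 - 1)) (χ (.diagonal, p.1 - 1, p.2)) (χ (.diagonal, p.1, p.2 - 1))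

/-- Domain wall boundary conditions at the node `p`, apart from those for the edges
`(.horizontal, n, 1)` and `(.vertical, 1, n)`; the diagonals on the West and
South boundaries have the state `g`. -/
def LocalBC (n : ℕ) (g : Bool) (p : ℕ × ℕ) (E N W S d e : Bool) : Prop :=
  if n + 2 ≤ p.1 + p.2 then
    (p.2 = n → N = false ∧ d = false) ∧ (p.1 = n → E = false ∧ e = false)
  else (p.1 = 1 → W = true ∧ d = g) ∧ (p.2 = 1 → S = true ∧ e = g)

instance (n : ℕ) (g : Bool) (p : ℕ × ℕ) (E N W S d e : Bool) :
    Decidable (LocalBC n g p E N W S d e) := by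
  unfold LocalBC
  infer_instance

/-- The weight of a node in the last column (`w true`) or elsewhere (`w false`), taking into
account the boundary conditions. -/
noncomputable def bcWeight (n : ℕ) (g : Bool)
    (w : Bool → Bool → Bool → Bool → Bool → Bool → Bool → ℂ)
    (p : ℕ × ℕ) (E N W S d e : Bool) : ℂ :=
  if LocalBC n g p E N W S d e then w (decide (p.1 = n)) E N W S d e else 0

/-- Boundary conditions for the edges `(.horizontal, n, 1)` and `(.vertical, 1, n)`. -/
noncomputable def midBC (n : ℕ) (χ : Edge → Bool) : ℂ :=
  if χ (.horizontal, n, 1) = false ∧ χ (.vertical, 1, n) = false then 1 else 0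

variable (n : ℕ) (g : Bool) (w : Bool → Bool → Bool → Bool → Bool → Bool → Bool → ℂ)

lemma atNode_lower {k i : ℕ} (hk : k < n) (hi : i ≤ k) :
    atNode (bcWeight n g w (i + 1, k + 1 - i)) (i + 1, k + 1 - i) =
      triNode lowerEdge (frozen true g fun _ i => w (decide (i + 1 = n))) k i := by
  ext χ
  have h1 : ¬ (n + 2 ≤ i + 1 + (k + 1 - i)) := by omega
  have h2 : k + 1 - i = 1 ↔ i = k := by omega
  have h3 : k + 1 + 1 - (i + 1) = k + 1 - i := by omega
  have h4 : k + 1 - i - 1 = k - i := by omega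
  have h5 : k + 1 - (i + 1) = k - i := by omega
  simp only [atNode, bcWeight, LocalBC, triNode, lowerEdge, frozen, h1, h2, h3, h4, h5, if_false,
    Nat.add_eq_right, Nat.add_sub_cancel]

lemma atNode_upper {k i : ℕ} (hk : k < n - 1) (hi : i ≤ k) :
    atNode (bcWeight n g w (n - k + i, n - i)) (n - k + i, n - i) =
      triNode (upperEdge n) (frozen false false fun k i S W N E d e =>
        w (decide (k - i = 0)) E N W S d e) k i := by
  ext χ
  have h1 : n + 2 ≤ n - k + i + (n - i) := by omega
  have h2 : n - i = n ↔ i = 0 := by omega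
  have h3 : n - k + i = n ↔ i = k := by omega
  have h3' : n - k + i = n ↔ k - i = 0 := by omega
  have h4 : n - (k + 1) + (i + 1) = n - k + i := by omega
  have h5 : n - (k + 1) + i = n - k + i - 1 := by omega
  have h6 : n - k + (i + 1) - 1 = n - k + i := by omega
  have h7 : n - (i + 1) = n - i - 1 := by omega
  simp only [atNode, bcWeight, LocalBC, triNode, upperEdge, frozen, h1, h2, h4, h5, h6, h7, if_true,
    ← h3']
  simp only [h3]

/-- Once the states of the edges between the triangles are fixed, the two triangles interact no more
and their partition functions factor. -/
theorem marginal_edges20V {n : ℕ} (hn : 1 ≤ n) :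
    marginal (edges dirs20V n)
        (midBC n * ∏ p ∈ grid n, atNode (bcWeight n g w p) p) =
      marginal (midEdges n) (midBC n *
        ((fun χ => triZ (frozen true g fun _ i => w (decide (i + 1 = n))) n
          (fun i => χ (lowerEdge (.horizontal, n, i + 1)))
          (fun i => χ (lowerEdge (.vertical, n, i)))) *
        fun χ => triZ (frozen false false fun k i S W N E d e => w (decide (k - i = 0)) E N W S d e)
          (n - 1) (fun i => χ (upperEdge n (.horizontal, n - 1, i + 1)))
          (fun i => χ (upperEdge n (.vertical, n - 1, i))))) := by
  have hd1 : Disjoint (midEdges n) (triEdges (upperEdge n) (n - 1) ∪ triEdges lowerEdge n) := by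
    rw [Finset.disjoint_left]
    rintro ⟨s, x, y⟩ h
    rw [mem_midEdges] at h
    rw [mem_union, mem_lower, mem_upper hn, if_neg h.1]
    omega
  have hd2 : Disjoint (triEdges (upperEdge n) (n - 1)) (triEdges lowerEdge n) := by
    rw [Finset.disjoint_left]
    rintro ⟨s, x, y⟩ h
    rw [mem_upper hn] at h
    rw [mem_lower]
    cases s <;> simp at h ⊢ <;> omega
  have hf1 : Free (triEdges (upperEdge n) (n - 1) ∪ triEdges lowerEdge n) (midBC n) := by
    intro χ χ' H
    rw [Finset.disjoint_left] at hd1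
    unfold midBC
    rw [H _ (hd1 (mem_midEdges.2 (by simp; omega))), H _ (hd1 (mem_midEdges.2 (by simp; omega)))]
  rw [edges20V_eq hn, marginal_union hd1, marginal_union hd2, grid_prod hn]
  congr 1
  rw [marginal_mul_left (hf1.mono subset_union_right),
    marginal_mul_left (hf1.mono subset_union_left)]
  congr 1
  have hlow : marginal (triEdges lowerEdge n) (∏ k ∈ range n, ∏ i ∈ range (k + 1),
      atNode (bcWeight n g w (i + 1, k + 1 - i)) (i + 1, k + 1 - i)) =
      fun χ => triZ (frozen true g fun _ i => w (decide (i + 1 = n))) n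
          (fun i => χ (lowerEdge (.horizontal, n, i + 1)))
          (fun i => χ (lowerEdge (.vertical, n, i))) := by
    ext χ
    rw [← marginal_triEdges (injOn_lowerEdge n) _ le_rfl]
    congr 1
    exact prod_congr rfl fun k hk => prod_congr rfl fun i hi =>
      atNode_lower n g w (by simpa using hk) (by simpa [Nat.lt_succ_iff] using hi)
  rw [marginal_mul_left, mul_comm, hlow, marginal_mul_left]
  · congr 1
    · ext χ
      rw [← marginal_triEdges (injOn_upperEdge hn) _ le_rfl]
      congr 1
      exact prod_congr rfl fun k hk => prod_congr rfl fun i hi =>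
        atNode_upper n g w (by simpa using hk) (by simpa [Nat.lt_succ_iff] using hi)
  · intro χ χ' H
    have key {s : Dir} {x y : ℕ} (hs : s ≠ .diagonal) (h : x + y ≤ n + 1) :
        (s, x, y) ∉ triEdges (upperEdge n) (n - 1) := by
      rw [mem_upper hn, if_neg hs]
      omega
    refine congrArg₂ (triZ _ n) (funext fun i => ?_) (funext fun i => ?_)
    · exact H _ (key (by simp) (by omega))
    · exact H _ (key (by simp) (by omega))
  · refine free_prod fun k hk => free_prod fun i hi => ?_
    rw [mem_range] at hk hi
    have key {s : Dir} {x y : ℕ} (h : n + 1 ≤ x + y) : (s, x, y) ∉ triEdges lowerEdge n := by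
      rw [mem_lower]
      omega
    intro χ χ' H
    unfold atNode
    rw [H _ (key _), H _ (key _), H _ (key _), H _ (key _), H _ (key _), H _ (key _)] <;>
      simp only <;> omega

/-- Removal of the diagonals of the square. -/
theorem marginal_weight20_eq_weight6 {a b c : ℂ} (hb : b ≠ 0)
    (hc : c ^ 2 = a ^ 2 + b ^ 2 - (Real.sqrt 2 : ℂ) * a * b) {n : ℕ} (hn : 1 ≤ n) :
    marginal (edges dirs20V n) (midBC n * ∏ p ∈ grid n,
        atNode (bcWeight n true (colParam weight20 a b c) p) p) =
      marginal (edges dirs20V n) (midBC n * ∏ p ∈ grid n,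
        atNode (bcWeight n false (fun l E N W S d e =>
          if d = false ∧ e = false then colParam weight6 a b c l E N W S else 0) p) p) := by
  rw [marginal_edges20V _ _ hn, marginal_edges20V _ _ hn, triZ_lower hb hc, triZ_upper hb hc]

/-! ### Configurations in terms of local rules -/

/-- The edge in the direction `s` into a node. -/
def inEdge (p : ℕ × ℕ) : Dir → Edge
  | .horizontal => (.horizontal, p.1 - 1, p.2)
  | .diagonal => (.diagonal, p.1 - 1, p.2)
  | .vertical => (.vertical, p.1, p.2)

/-- The edge in the direction `s` out of a node. -/
def outEdge (p : ℕ × ℕ) : Dir → Edge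
  | .horizontal => (.horizontal, p.1, p.2)
  | .diagonal => (.diagonal, p.1, p.2 - 1)
  | .vertical => (.vertical, p.1, p.2 - 1)

lemma mem_edges_iff {D : Finset Dir} {n : ℕ} {e : Edge} :
    e ∈ edges D n ↔ e.1 ∈ D ∧ e ∈ edges dirs20V n := by
  obtain ⟨s, x, y⟩ := e
  cases s <;> simp [edges, dirs20V] <;> tauto

lemma inEdge_fst (p : ℕ × ℕ) (s : Dir) : (inEdge p s).1 = s := by cases s <;> rfl

lemma outEdge_fst (p : ℕ × ℕ) (s : Dir) : (outEdge p s).1 = s := by cases s <;> rfl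

lemma mem_edges20V_iff {n : ℕ} {e : Edge} :
    e ∈ edges dirs20V n ↔ src e ∈ grid n ∨ tgt e ∈ grid n := by
  obtain ⟨s, x, y⟩ := e
  cases s <;> simp [edges, dirs20V, grid, src, tgt] <;> omega

lemma tgt_eq_iff {n : ℕ} {p : ℕ × ℕ} (hp : p ∈ grid n) (e : Edge) :
    tgt e = p ↔ inEdge p e.1 = e := by
  obtain ⟨x, y⟩ := p
  obtain ⟨s, x', y'⟩ := e
  simp only [grid, mem_product, mem_Icc] at hp
  cases s <;> simp [tgt, inEdge] <;> omega

lemma src_eq_iff {n : ℕ} {p : ℕ × ℕ} (hp : p ∈ grid n) (e : Edge) :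
    src e = p ↔ outEdge p e.1 = e := by
  obtain ⟨x, y⟩ := p
  obtain ⟨s, x', y'⟩ := e
  simp only [grid, mem_product, mem_Icc] at hp
  cases s <;> simp [src, outEdge] <;> omega

lemma tgt_inEdge {n : ℕ} {p : ℕ × ℕ} (hp : p ∈ grid n) (s : Dir) : tgt (inEdge p s) = p := by
  rw [tgt_eq_iff hp, inEdge_fst]

lemma src_outEdge {n : ℕ} {p : ℕ × ℕ} (hp : p ∈ grid n) (s : Dir) : src (outEdge p s) = p := by
  rw [src_eq_iff hp, outEdge_fst]

open Classical in
lemma filter_tgt {D : Finset Dir} {n : ℕ} {p : ℕ × ℕ} (hp : p ∈ grid n) :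
    (edges D n).filter (fun e => tgt e = p) = D.image (inEdge p) := by
  ext e
  rw [mem_filter, mem_image, mem_edges_iff]
  constructor
  · rintro ⟨⟨h, -⟩, h'⟩
    exact ⟨e.1, h, (tgt_eq_iff hp e).1 h'⟩
  · rintro ⟨s, hs, rfl⟩
    have := tgt_inEdge hp s
    exact ⟨⟨by rwa [inEdge_fst], mem_edges20V_iff.2 (.inr (by rwa [this]))⟩, this⟩

open Classical in
lemma filter_src {D : Finset Dir} {n : ℕ} {p : ℕ × ℕ} (hp : p ∈ grid n) :
    (edges D n).filter (fun e => src e = p) = D.image (outEdge p) := by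
  ext e
  rw [mem_filter, mem_image, mem_edges_iff]
  constructor
  · rintro ⟨⟨h, -⟩, h'⟩
    exact ⟨e.1, h, (src_eq_iff hp e).1 h'⟩
  · rintro ⟨s, hs, rfl⟩
    have := src_outEdge hp s
    exact ⟨⟨by rwa [outEdge_fst], mem_edges20V_iff.2 (.inl (by rwa [this]))⟩, this⟩

lemma card_filter_tgt {D : Finset Dir} {n : ℕ} {p : ℕ × ℕ} (hp : p ∈ grid n) (q : Edge → Prop)
    [DecidablePred q] [DecidablePred fun e => q e ∧ tgt e = p] :
    ((edges D n).filter fun e => q e ∧ tgt e = p).card =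
      (D.filter fun s => q (inEdge p s)).card := by
  classical
  rw [show ((edges D n).filter fun e => q e ∧ tgt e = p) =
    ((edges D n).filter fun e => tgt e = p).filter q by ext; simp only [mem_filter]; tauto, filter_tgt hp,
    filter_image, card_image_of_injective]
  exact fun s t h => by rw [← inEdge_fst p s, h, inEdge_fst]

lemma card_filter_src {D : Finset Dir} {n : ℕ} {p : ℕ × ℕ} (hp : p ∈ grid n) (q : Edge → Prop)
    [DecidablePred q] [DecidablePred fun e => q e ∧ src e = p] :
    ((edges D n).filter fun e => q e ∧ src e = p).card =
      (D.filter fun s => q (outEdge p s)).card := by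
  classical
  rw [show ((edges D n).filter fun e => q e ∧ src e = p) =
    ((edges D n).filter fun e => src e = p).filter q by ext; simp only [mem_filter]; tauto, filter_src hp,
    filter_image, card_image_of_injective]
  exact fun s t h => by rw [← outEdge_fst p s, h, outEdge_fst]

/-- A node has `D.card` edges on its incoming side and as many on its outgoing side. Unoccupied
edges reverse their role, so both counts equal `D.card` exactly when the numbers of occupied edges
on the two sides agree. -/
lemma iceRule_iff {D : Finset Dir} {n : ℕ} {ω : Finset Edge} :
    IceRule D n ω ↔ ∀ p ∈ grid n,
      (D.filter fun s => inEdge p s ∈ ω).card = (D.filter fun s => outEdge p s ∈ ω).card := by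
  classical
  refine forall₂_congr fun p hp => ?_
  have key : ((edges D n).filter fun e => PointsTo ω e p).card =
      (D.filter fun s => inEdge p s ∈ ω).card + (D.filter fun s => ¬ outEdge p s ∈ ω).card := by
    rw [show ((edges D n).filter fun e => PointsTo ω e p) =
      ((edges D n).filter fun e => e ∈ ω ∧ tgt e = p) ∪
        ((edges D n).filter fun e => ¬ e ∈ ω ∧ src e = p) by
        ext; rw [mem_filter, mem_union, mem_filter, mem_filter]; unfold PointsTo; tauto, card_union_of_disjoint,
      card_filter_tgt hp fun e => e ∈ ω, card_filter_src hp fun e => ¬ e ∈ ω]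
    rw [disjoint_filter]
    tauto
  have key' : ((edges D n).filter fun e => PointsFrom ω e p).card =
      (D.filter fun s => outEdge p s ∈ ω).card + (D.filter fun s => ¬ inEdge p s ∈ ω).card := by
    rw [show ((edges D n).filter fun e => PointsFrom ω e p) =
      ((edges D n).filter fun e => e ∈ ω ∧ src e = p) ∪
        ((edges D n).filter fun e => ¬ e ∈ ω ∧ tgt e = p) by
        ext; rw [mem_filter, mem_union, mem_filter, mem_filter]; unfold PointsFrom; tauto, card_union_of_disjoint,
      card_filter_src hp fun e => e ∈ ω, card_filter_tgt hp fun e => ¬ e ∈ ω]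
    rw [disjoint_filter]
    tauto
  rw [key, key']
  have h1 := card_filter_add_card_filter_not (s := D) fun s => inEdge p s ∈ ω
  have h2 := card_filter_add_card_filter_not (s := D) fun s => outEdge p s ∈ ω
  omega

/-- The states of the edges in a configuration. -/
def states (ω : Finset Edge) (e : Edge) : Bool := decide (e ∈ ω)

/-- The local rules which characterise the configurations. -/
structure LocalRules (n : ℕ) (g : Bool) (ω : Finset Edge) : Prop where
  subset : ω ⊆ edges dirs20V n
  diagonal : g = false → ∀ e ∈ ω, e.1 ≠ .diagonal
  ice : ∀ p ∈ grid n, atNode Ice p (states ω)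
  bc : ∀ p ∈ grid n, atNode (LocalBC n g p) p (states ω)
  east : (.horizontal, n, 1) ∉ ω
  north : (.vertical, 1, n) ∉ ω

/-- The corner nodes `(1, n)` and `(n, 1)` fall under the West/South clause of `LocalBC`; hence
their North and East edges are listed separately. -/
lemma isDWBC1_iff {D : Finset Dir} {n : ℕ} (hn : 1 ≤ n) (h1 : .horizontal ∈ D)
    (h2 : .vertical ∈ D) {ω : Finset Edge} (hω : ω ⊆ edges D n) :
    IsDWBC1 D n ω ↔ (∀ p ∈ grid n, atNode (LocalBC n (decide (.diagonal ∈ D)) p) p (states ω)) ∧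
      (.horizontal, n, 1) ∉ ω ∧ (.vertical, 1, n) ∉ ω := by
  have hmem {s : Dir} {x y : ℕ} (h : (s, x, y) ∈ ω) : (s, x, y) ∈ edges D n := hω h
  have hD {s : Dir} {x y : ℕ} (hs : s ∈ D) (h : (s, x, y) ∈ edges dirs20V n) :
    (s, x, y) ∈ edges D n := mem_edges_iff.2 ⟨hs, h⟩
  have hbot {x y : ℕ} (h : (Dir.diagonal, x, y) ∈ edges dirs20V n)
      (h' : (Dir.diagonal, x, y) ∈ edges D n → (Dir.diagonal, x, y) ∈ ω) :
      states ω (.diagonal, x, y) = decide (Dir.diagonal ∈ D) := by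
    simp only [states, decide_eq_decide]
    exact ⟨fun h => (mem_edges_iff.1 (hω h)).1, fun hd => h' (hD hd h)⟩
  constructor
  · rintro ⟨hw, hs, he, hn'⟩
    refine ⟨?_, ?_, ?_⟩
    · rintro ⟨x, y⟩ hp
      simp only [grid, mem_product, mem_Icc] at hp
      unfold atNode LocalBC
      split_ifs with h
      · simp only at h
        refine ⟨fun hxy => ⟨?_, ?_⟩, fun hxy => ⟨?_, ?_⟩⟩ <;> simp only at hxy ⊢ <;>
          rw [states, decide_eq_false_iff_not] <;> intro hmem'
        · exact hn' _ (hmem hmem') (by simp [src]; omega) (by simp [src]; omega) hmem'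
        · exact hn' _ (hmem hmem') (by simp [src]; omega) (by simp [src]; omega) hmem'
        · exact he _ (hmem hmem') (by simp [tgt]; omega) (by simp [tgt]; omega) hmem'
        · exact he _ (hmem hmem') (by simp [tgt]; omega) (by simp [tgt]; omega) hmem'
      · simp only at h
        refine ⟨fun hxy => ⟨?_, ?_⟩, fun hxy => ⟨?_, ?_⟩⟩ <;> simp only at hxy ⊢
        · rw [states, decide_eq_true_eq]
          exact hw _ (hD h1 (mem_edges20V.2 (by simp; omega))) (by simp [src]; omega)
        · exact hbot (mem_edges20V.2 (by simp; omega)) fun h' => hw _ h' (by simp [src]; omega)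
        · rw [states, decide_eq_true_eq]
          exact hs _ (hD h2 (mem_edges20V.2 (by simp; omega))) (by simp [tgt]; omega)
        · exact hbot (mem_edges20V.2 (by simp; omega)) fun h' => hs _ h' (by simp [tgt]; omega)
    · exact fun hmem' => he _ (hmem hmem') (by simp [tgt]) (by simp [tgt]) hmem'
    · exact fun hmem' => hn' _ (hmem hmem') (by simp [src]) (by simp [src]) hmem'
  · rintro ⟨H, he, hn'⟩
    have H' (x y : ℕ) (hx : 1 ≤ x ∧ x ≤ n) (hy : 1 ≤ y ∧ y ≤ n) := H (x, y) (by
      simp [grid]; omega)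
    unfold atNode LocalBC at H'
    constructor
    · rintro ⟨s, x, y⟩ h hx
      have h' := mem_edges20V.1 (mem_edges_iff.1 h).2
      have hs := (mem_edges_iff.1 h).1
      have := H' 1 y
      cases s <;> simp [src] at hx h' <;> subst hx
      · rw [if_neg (by simp; omega)] at this
        simpa [states] using ((this (by omega) (by omega)).1 rfl).1
      · rw [if_neg (by simp; omega)] at this
        have := ((this (by omega) (by omega)).1 rfl).2
        simpa [states, hs] using this
      · omega
    · rintro ⟨s, x, y⟩ h hx
      have h' := mem_edges20V.1 (mem_edges_iff.1 h).2
      have hs := (mem_edges_iff.1 h).1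
      have := H' x 1
      cases s <;> simp [tgt] at hx h' <;> subst hx
      · omega
      · rw [if_neg (by simp; omega)] at this
        have := ((this (by omega) (by omega)).2 rfl).2
        simpa [states, hs] using this
      · rw [if_neg (by simp; omega)] at this
        simpa [states] using ((this (by omega) (by omega)).2 rfl).1
    · rintro ⟨s, x, y⟩ h hx hy
      have h' := mem_edges20V.1 (mem_edges_iff.1 h).2
      cases s <;> simp [tgt] at hx h' hy
      · subst hx
        rcases eq_or_ne y 1 with rfl | hy1
        · exact he
        have := H' x y
        rw [if_pos (by simp; omega)] at this
        simpa [states] using ((this (by omega) (by omega)).2 rfl).1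
      · subst hx
        have := H' x (y + 1)
        rw [if_pos (by simp; omega)] at this
        simpa [states] using ((this (by omega) (by omega)).2 rfl).2
      · omega
    · rintro ⟨s, x, y⟩ h hx hy
      have h' := mem_edges20V.1 (mem_edges_iff.1 h).2
      cases s <;> simp [src] at hx h' hy
      · omega
      · subst hx
        have := H' (x + 1) y
        rw [if_pos (by simp; omega)] at this
        simpa [states] using ((this (by omega) (by omega)).1 rfl).2
      · subst hx
        rcases eq_or_ne x 1 with rfl | hx1
        · exact hn'
        have := H' x y
        rw [if_pos (by simp; omega)] at this
        simpa [states] using ((this (by omega) (by omega)).1 rfl).1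

lemma iceRule_iff_atNode {D : Finset Dir} {n : ℕ} {ω : Finset Edge} (hω : ω ⊆ edges D n) :
    IceRule D n ω ↔ ∀ p ∈ grid n, atNode Ice p (states ω) := by
  rw [iceRule_iff]
  refine forall₂_congr fun p hp => ?_
  have key (f : Dir → Edge) (hf : ∀ s, (f s).1 = s) : (D.filter fun s => f s ∈ ω).card =
      (states ω (f .horizontal)).toNat + (states ω (f .vertical)).toNat +
        (states ω (f .diagonal)).toNat := by
    have : (D.filter fun s => f s ∈ ω) =
        ({.horizontal, .vertical, .diagonal} : Finset Dir).filter fun s => f s ∈ ω := by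
      ext s
      have : f s ∈ ω → s ∈ D := fun h => by
        have := (mem_edges_iff.1 (hω h)).1
        rwa [hf] at this
      cases s <;> simp <;> tauto
    rw [this, card_filter]
    rw [sum_insert (by simp), sum_insert (by simp), sum_singleton, ← add_assoc]
    simp only [states, Bool.toNat, Bool.cond_decide]
  rw [key _ (inEdge_fst p), key _ (outEdge_fst p)]
  rfl

/-- Describes both models on the same edge set: 6V configurations are those on the triangular
lattice with all diagonals unoccupied. -/
lemma mem_configs_iff {D : Finset Dir} {n : ℕ} (hn : 1 ≤ n) (h1 : .horizontal ∈ D)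
    (h2 : .vertical ∈ D) {ω : Finset Edge} :
    ω ∈ configs D n ↔ LocalRules n (decide (.diagonal ∈ D)) ω := by
  have hsub : ω ⊆ edges D n ↔ ω ⊆ edges dirs20V n ∧
      (decide (.diagonal ∈ D) = false → ∀ e ∈ ω, e.1 ≠ .diagonal) := by
    constructor
    · intro h
      refine ⟨fun e he => (mem_edges_iff.1 (h he)).2, fun hd e he => ?_⟩
      have := (mem_edges_iff.1 (h he)).1
      rintro h'
      rw [h'] at this
      simp [this] at hd
    · rintro ⟨h, h'⟩ e he
      refine mem_edges_iff.2 ⟨?_, h he⟩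
      have := fun hd => h' hd e he
      rcases hs : e.1 with _ | _ | _
      · exact h1
      · by_contra hD
        exact this (by simpa using hD) hs
      · exact h2
  classical
  rw [configs, mem_filter, mem_powerset]
  constructor
  · rintro ⟨hω, hbc, hice⟩
    rw [isDWBC1_iff hn h1 h2 hω] at hbc
    rw [iceRule_iff_atNode hω] at hice
    exact ⟨(hsub.1 hω).1, (hsub.1 hω).2, hice, hbc.1, hbc.2.1, hbc.2.2⟩
  · rintro ⟨ha, hb, hice, hbc, he, hn'⟩
    have hω := hsub.2 ⟨ha, hb⟩
    rw [isDWBC1_iff hn h1 h2 hω, iceRule_iff_atNode hω]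
    exact ⟨hω, ⟨hbc, he, hn'⟩, hice⟩

/-! ### The uppermost path -/

/-- Among the occupied edges out of a node, the number of steps above an edge strictly increases
with its level, and source and level determine the edge. -/
lemma Follows.right_unique {ω : Finset Edge} : Relator.RightUnique (Follows ω) := by
  intro e f f' h h'
  have hs : src f = src f' := h.2.2.1.symm.trans h'.2.2.1
  have key {f f' : Edge} (hf : f ∈ ω) (hs : src f = src f')
      (hc : (ω.filter fun g => src g = src f ∧ level g.1 < level f.1).card =
        (ω.filter fun g => src g = src f' ∧ level g.1 < level f'.1).card) :
      level f'.1 ≤ level f.1 := by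
    by_contra! hlt
    refine (card_lt_card (Finset.ssubset_iff.2 ⟨f, ?_, ?_⟩)).ne hc
    · simp
    · rw [insert_subset_iff]
      refine ⟨by simp [hf, hs, hlt], fun g hg => ?_⟩
      rw [mem_filter] at hg ⊢
      exact ⟨hg.1, hg.2.1.trans hs, hg.2.2.trans hlt⟩
  have hc := h.2.2.2.symm.trans h'.2.2.2
  have hl := (key h.2.1 hs hc).antisymm (key h'.2.1 hs.symm hc.symm)
  obtain ⟨s, x, y⟩ := f
  obtain ⟨s', x', y'⟩ := f'
  obtain rfl : s = s' := by cases s <;> cases s' <;> simp [level] at hl ⊢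
  cases s <;> simp [src] at hs <;> simp [hs]

lemma src_fst_le_tgt (e : Edge) : (src e).1 ≤ (tgt e).1 := by
  obtain ⟨s, x, y⟩ := e
  cases s <;> simp [src, tgt]

lemma src_fst_mono {ω : Finset Edge} {e f : Edge} (h : Relation.ReflTransGen (Follows ω) e f) :
    (src e).1 ≤ (src f).1 := by
  induction h with
  | refl => exact le_rfl
  | tail _ h ih =>
    rw [← h.2.2.1]
    exact ih.trans (src_fst_le_tgt _)

/-- A path cannot hit the line `x = n` from outside more than once. -/
lemma height_eq_of_reflTransGen {ω : Finset Edge} {n l l' : ℕ} {e e' : Edge}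
    (h : Relation.ReflTransGen (Follows ω) e e') (he : tgt e = (n, l))
    (hs : (src e').1 ≠ n) (he' : tgt e' = (n, l')) : l = l' := by
  rcases h.cases_head with rfl | ⟨f, hf, hfe⟩
  · simpa using he.symm.trans he'
  · have h1 := src_fst_mono hfe
    rw [← hf.2.2.1, he] at h1
    have h2 := src_fst_le_tgt e'
    rw [he'] at h2
    exact absurd (le_antisymm h2 h1) hs

lemma FirstHits.height_unique {n l l' : ℕ} {ω : Finset Edge} {s : Edge}
    (h : FirstHits n ω s l) (h' : FirstHits n ω s l') : l = l' := by
  obtain ⟨e, hse, hne, he⟩ := h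
  obtain ⟨e', hse', hne', he'⟩ := h'
  rcases Relation.ReflTransGen.total_of_right_unique Follows.right_unique hse hse' with h | h
  · exact height_eq_of_reflTransGen h he hne' he'
  · exact (height_eq_of_reflTransGen h he' hne he).symm

/-- The node `(x, y)` is not visited by paths. -/
structure EmptyNode (ω : Finset Edge) (x y : ℕ) : Prop where
  west : (.horizontal, x - 1, y) ∉ ω
  north : (.vertical, x, y) ∉ ω
  northWest : (.diagonal, x - 1, y) ∉ ω
  east : (.horizontal, x, y) ∉ ω
  south : (.vertical, x, y - 1) ∉ ω
  southEast : (.diagonal, x, y - 1) ∉ ω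

/-! ### Consequences of the local rules and tracing back the uppermost path -/

variable {n : ℕ} {g : Bool} {ω : Finset Edge}

lemma LocalRules.emptyNode_of_out (h : LocalRules n g ω) {x y : ℕ} (hx : 1 ≤ x ∧ x ≤ n)
    (hy : 1 ≤ y ∧ y ≤ n) (h1 : (.horizontal, x, y) ∉ ω) (h2 : (.vertical, x, y - 1) ∉ ω)
    (h3 : (.diagonal, x, y - 1) ∉ ω) : EmptyNode ω x y := by
  have := h.ice (x, y) (by simp [grid]; omega)
  simp [atNode, Ice, states, h1, h2, h3] at this
  exact ⟨this.1.1, this.1.2, this.2, h1, h2, h3⟩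

lemma LocalRules.exists_in (h : LocalRules n g ω) {x y : ℕ} (hx : 1 ≤ x ∧ x ≤ n)
    (hy : 1 ≤ y ∧ y ≤ n) {e : Edge} (he : e ∈ ω) (hs : src e = (x, y)) :
    (.horizontal, x - 1, y) ∈ ω ∨ (.vertical, x, y) ∈ ω ∨ (.diagonal, x - 1, y) ∈ ω := by
  by_contra! hc
  obtain ⟨h1, h2, h3⟩ := hc
  have := h.ice (x, y) (by simp [grid]; omega)
  simp [atNode, Ice, states, h1, h2, h3] at this
  have hp : (x, y) ∈ grid n := by simp [grid]; omega
  rw [src_eq_iff hp] at hs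
  obtain ⟨s, x', y'⟩ := e
  cases s <;> simp [outEdge] at hs <;> simp_all <;> omega

lemma LocalRules.bc' (h : LocalRules n g ω) {x y : ℕ} (hx : 1 ≤ x ∧ x ≤ n)
    (hy : 1 ≤ y ∧ y ≤ n) : LocalBC n g (x, y) (states ω (.horizontal, x, y))
      (states ω (.vertical, x, y)) (states ω (.horizontal, x - 1, y))
      (states ω (.vertical, x, y - 1)) (states ω (.diagonal, x - 1, y))
      (states ω (.diagonal, x, y - 1)) :=
  h.bc (x, y) (by simp [grid]; omega)

lemma LocalRules.east_notMem (h : LocalRules n g ω) {y : ℕ} (hy : 1 ≤ y) :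
    (.horizontal, n, y) ∉ ω := by
  intro hm
  have := mem_edges20V.1 (h.subset hm)
  simp at this
  rcases eq_or_ne y 1 with rfl | hy1
  · exact h.east hm
  have hb := h.bc' (x := n) (y := y) (by omega) (by omega)
  rw [LocalBC, if_pos (by simp; omega)] at hb
  simpa [states, hm] using (hb.2 rfl).1

lemma LocalRules.diagonal_east_notMem (h : LocalRules n g ω) {y : ℕ} (hy : 1 ≤ y) :
    (.diagonal, n, y) ∉ ω := by
  intro hm
  have := mem_edges20V.1 (h.subset hm)
  simp at this
  have hb := h.bc' (x := n) (y := y + 1) (by omega) (by omega)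
  rw [LocalBC, if_pos (by simp; omega)] at hb
  simpa [states, hm] using (hb.2 rfl).2

lemma LocalRules.north_notMem (h : LocalRules n g ω) {x : ℕ} (hx : 1 ≤ x) :
    (.vertical, x, n) ∉ ω := by
  intro hm
  have := mem_edges20V.1 (h.subset hm)
  simp at this
  rcases eq_or_ne x 1 with rfl | hx1
  · exact h.north hm
  have hb := h.bc' (x := x) (y := n) (by omega) (by omega)
  rw [LocalBC, if_pos (by simp; omega)] at hb
  simpa [states, hm] using (hb.1 rfl).1

lemma LocalRules.diagonal_north_notMem (h : LocalRules n g ω) {x : ℕ} (hx : 1 ≤ x) :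
    (.diagonal, x, n) ∉ ω := by
  intro hm
  have := mem_edges20V.1 (h.subset hm)
  simp at this
  have hb := h.bc' (x := x + 1) (y := n) (by omega) (by omega)
  rw [LocalBC, if_pos (by simp; omega)] at hb
  simpa [states, hm] using (hb.1 rfl).2

lemma LocalRules.west_mem (h : LocalRules n g ω) {y : ℕ} (hy : 1 ≤ y ∧ y ≤ n) :
    (.horizontal, 0, y) ∈ ω := by
  have hb := h.bc' (x := 1) (y := y) (by omega) (by omega)
  rw [LocalBC, if_neg (by simp; omega)] at hb
  simpa [states] using (hb.1 rfl).1

lemma LocalRules.diagonal_west_mem (h : LocalRules n g ω) {y : ℕ} (hy : 1 ≤ y ∧ y ≤ n) :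
    (.diagonal, 0, y) ∈ ω ↔ g = true := by
  have hb := h.bc' (x := 1) (y := y) (by omega) (by omega)
  rw [LocalBC, if_neg (by simp; omega)] at hb
  simp [states] at hb
  rw [← (hb.1).2]
  simp

lemma LocalRules.south_mem (h : LocalRules n g ω) {x : ℕ} (hx : 1 ≤ x ∧ x ≤ n) :
    (.vertical, x, 0) ∈ ω := by
  have hb := h.bc' (x := x) (y := 1) (by omega) (by omega)
  rw [LocalBC, if_neg (by simp; omega)] at hb
  simpa [states] using (hb.2 rfl).1

lemma LocalRules.diagonal_south_mem (h : LocalRules n g ω) {x : ℕ} (hx : 1 ≤ x ∧ x ≤ n) :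
    (.diagonal, x, 0) ∈ ω ↔ g = true := by
  have hb := h.bc' (x := x) (y := 1) (by omega) (by omega)
  rw [LocalBC, if_neg (by simp; omega)] at hb
  simp [states] at hb
  rw [← (hb.2).2]
  simp

lemma LocalRules.notMem (h : LocalRules n g ω) {s : Dir} {x y : ℕ} (hxy : n < x ∨ n < y) :
    (s, x, y) ∉ ω := by
  intro hm
  have := mem_edges20V.1 (h.subset hm)
  omega

lemma LocalRules.emptyNode_of_outside (h : LocalRules n g ω) {x y : ℕ} (hx : 1 ≤ x) (hy : 1 ≤ y)
    (hxy : n < x ∨ n < y) : EmptyNode ω x y := by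
  rcases eq_or_ne x (n + 1) with rfl | hx1
  · exact ⟨h.east_notMem hy, h.notMem (by omega), h.diagonal_east_notMem hy, h.notMem (by omega),
      h.notMem (by omega), h.notMem (by omega)⟩
  rcases eq_or_ne y (n + 1) with rfl | hy1
  · exact ⟨h.notMem (by omega), h.notMem (by omega), h.notMem (by omega), h.notMem (by omega),
      h.north_notMem hx, h.diagonal_north_notMem hx⟩
  · exact ⟨h.notMem (by omega), h.notMem (by omega), h.notMem (by omega), h.notMem (by omega),
      h.notMem (by omega), h.notMem (by omega)⟩

/-- The step `e` is taken by a path, and no path passes above it. -/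
structure IsTop (ω : Finset Edge) (e : Edge) : Prop where
  mem : e ∈ ω
  quadrant : ∀ x y, (src e).1 < x → (src e).2 < y → EmptyNode ω x y
  diagonal : (.diagonal, (src e).1, (src e).2) ∉ ω
  level_le : ∀ f ∈ ω, src f = src e → level e.1 ≤ level f.1

lemma IsTop.follows {e e' : Edge} (h : IsTop ω e) (h' : e' ∈ ω) (heq : tgt e' = src e)
    (hl : ∀ f ∈ ω, tgt f = tgt e' → level f.1 ≤ level e'.1) : Follows ω e' e := by
  refine ⟨h', h.mem, heq, ?_⟩
  rw [filter_eq_empty_iff.2, filter_eq_empty_iff.2]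
  · rintro f hf ⟨h1, h2⟩
    have := h.level_le f hf h1
    omega
  · rintro f hf ⟨h1, h2⟩
    have := hl f hf h1
    omega

/-- The first step of the uppermost path. -/
def topStart (n : ℕ) (g : Bool) : Edge := if g then start20V n else start6V n

/-- A lower starting step would have an occupied West boundary edge in its empty quadrant, or an
occupied boundary diagonal just above it. -/
lemma LocalRules.eq_topStart (h : LocalRules n g ω) (hn : 1 ≤ n) {e : Edge} (he : IsTop ω e)
    (hx : (src e).1 = 0) : e = topStart n g := by
  have hm := h.subset he.mem
  have hd := h.diagonal
  have h0 := he.mem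
  have h1 := he.quadrant 1 n (by omega)
  have h2 := he.diagonal
  have h3 := h.west_mem (y := n) (by omega)
  have h4 := h.diagonal_west_mem (y := n) (by omega)
  obtain ⟨s, x, y⟩ := e
  have hm := mem_edges20V.1 hm
  have hd' := fun hg => hd hg _ h0
  cases s <;> simp [src] at hx h1 h2 hm hd' <;> subst hx
  · rcases hm.2.1.lt_or_eq with hlt | rfl
    · exact absurd h3 (h1 hlt).west
    · cases g
      · rfl
      · exact absurd (h4.2 rfl) h2
  · subst hd'
    rcases lt_trichotomy (y + 1) n with hlt | heq | hgt
    · exact absurd h3 (h1 hlt).west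
    · subst heq
      exact absurd (h4.2 rfl) h2
    · obtain rfl : y = n := by omega
      rfl
  · omega

/-- The highest step into the source of a top step is again a top step and precedes it on its path.
Tracing back in this way ends on the West boundary. -/
theorem LocalRules.reflTransGen_of_isTop (h : LocalRules n g ω) (hn : 1 ≤ n) {e : Edge}
    (he : IsTop ω e) : Relation.ReflTransGen (Follows ω) (topStart n g) e := by
  -- Abscissa plus depth below the line `y = n + 1` decreases with every step backwards.
  obtain ⟨N, hN⟩ : ∃ N, (src e).1 + (n + 1 - (src e).2) = N := ⟨_, rfl⟩
  induction N using Nat.strong_induction_on generalizing e with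
  | _ N ih =>
  rcases Nat.eq_zero_or_pos (src e).1 with hx0 | hx0
  · rw [h.eq_topStart hn he hx0]
  obtain ⟨x, y, hp⟩ : ∃ x y, src e = (x, y) := ⟨_, _, rfl⟩
  obtain ⟨hm, hquad, hdiag, hlev⟩ := id he
  rw [hp] at hx0 hN hquad hdiag hlev
  simp only at hx0 hN hquad hdiag
  have hgrid : (1 ≤ x ∧ x ≤ n) ∧ (1 ≤ y ∧ y ≤ n) := by
    obtain ⟨s, x', y'⟩ := e
    have hm' := mem_edges20V.1 (h.subset hm)
    cases s <;> simp [src] at hp hm' <;> obtain ⟨rfl, rfl⟩ := hp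
    · omega
    · have : y' ≠ n := fun hy => h.diagonal_north_notMem hx0 (hy ▸ hm)
      omega
    · have : y' ≠ n := fun hy => h.north_notMem hx0 (hy ▸ hm)
      omega
  have hp' : (x, y) ∈ grid n := by simp [grid]; omega
  have step (s : Dir) (hs : inEdge (x, y) s ∈ ω) (htop : IsTop ω (inEdge (x, y) s))
      (hl : ∀ t, inEdge (x, y) t ∈ ω → level t ≤ level s)
      (hlt : (src (inEdge (x, y) s)).1 + (n + 1 - (src (inEdge (x, y) s)).2) < N) :
      Relation.ReflTransGen (Follows ω) (topStart n g) e := by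
    refine (ih _ hlt htop rfl).tail (he.follows hs ?_ ?_)
    · rw [hp, tgt_inEdge hp']
    · intro f hf hft
      rw [tgt_inEdge hp', tgt_eq_iff hp'] at hft
      rw [inEdge_fst]
      exact hl _ (by rwa [hft])
  have hne := hquad (x + 1) (y + 1) (by omega) (by omega)
  by_cases hv : (Dir.vertical, x, y) ∈ ω
  · refine step .vertical hv ⟨hv, ?_, ?_, ?_⟩ ?_ ?_
    · intro x' y' h1 h2
      simp only [src, inEdge] at h1 h2
      exact hquad x' y' h1 (by omega)
    · exact hne.northWest
    · rintro ⟨s, x', y'⟩ hf hs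
      simp [inEdge, src] at hs
      cases s <;> simp at hs <;> obtain ⟨rfl, rfl⟩ := hs
      · exact absurd hf hne.west
      · exact absurd hf hdiag
      · exact le_rfl
    · intro t _
      cases t <;> simp [level]
    · simp only [inEdge, src]
      omega
  -- Without a step from the North, the node above has no outgoing step, hence by the ice rule no
  -- incoming one, and this propagates up the column.
  have hcol : ∀ k, EmptyNode ω x (y + 1 + k) := by
    intro k
    induction k with
    | zero =>
      by_cases hyn : y + 1 ≤ n
      · exact h.emptyNode_of_out hgrid.1 ⟨by omega, hyn⟩ hne.west hv hdiag
      · exact h.emptyNode_of_outside hx0 (by omega) (by omega)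
    | succ k ih =>
      by_cases hyn : y + 1 + (k + 1) ≤ n
      · exact h.emptyNode_of_out hgrid.1 ⟨by omega, hyn⟩
          (hquad (x + 1) (y + 1 + (k + 1)) (by omega) (by omega)).west ih.north
          (hquad (x + 1) (y + 1 + k) (by omega) (by omega)).northWest
      · exact h.emptyNode_of_outside hx0 (by omega) (by omega)
  have hquad' : ∀ x' y', x - 1 < x' → y < y' → EmptyNode ω x' y' := by
    intro x' y' h1 h2
    rcases (show x ≤ x' by omega).eq_or_lt with rfl | h3
    · have := hcol (y' - y - 1)
      rwa [show y + 1 + (y' - y - 1) = y' by omega] at this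
    · exact hquad x' y' h3 h2
  by_cases hd : (Dir.diagonal, x - 1, y) ∈ ω
  · refine step .diagonal hd ⟨hd, ?_, ?_, ?_⟩ ?_ ?_
    · intro x' y' h1 h2
      simp only [src, inEdge] at h1 h2
      exact hquad' x' y' h1 (by omega)
    · exact (hcol 0).northWest
    · rintro ⟨s, x', y'⟩ hf hs
      simp [inEdge, src] at hs
      cases s <;> simp at hs <;> obtain ⟨rfl, rfl⟩ := hs
      · exact absurd hf (hcol 0).west
      · exact le_rfl
      · simp [level, inEdge]
    · intro t ht
      cases t <;> simp [level]
      exact hv ht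
    · simp only [inEdge, src]
      omega
  · have hh : (Dir.horizontal, x - 1, y) ∈ ω := by
      rcases h.exists_in hgrid.1 hgrid.2 hm hp with h1 | h1 | h1
      · exact h1
      · exact absurd h1 hv
      · exact absurd h1 hd
    refine step .horizontal hh ⟨hh, ?_, ?_, ?_⟩ ?_ ?_
    · exact hquad'
    · exact hd
    · rintro f hf hs
      simp [inEdge, level]
    · intro t ht
      cases t
      · simp
      · exact absurd ht hd
      · exact absurd ht hv
    · simp only [inEdge, src]
      omega

/-- The uppermost path hits the last column at the highest node which is visited. -/
theorem LocalRules.firstHits_iff (h : LocalRules n g ω) {l : ℕ} (hl : 1 ≤ l ∧ l ≤ n)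
    (hempty : ∀ y, l < y → y ≤ n → EmptyNode ω n y)
    (hin : (.horizontal, n - 1, l) ∈ ω ∨ (.diagonal, n - 1, l) ∈ ω) (l' : ℕ) :
    FirstHits n ω (topStart n g) l' ↔ l' = l := by
  have hquad : ∀ x y, n - 1 < x → l < y → EmptyNode ω x y := by
    intro x y hx hy
    by_cases hxy : x ≤ n ∧ y ≤ n
    · obtain rfl : x = n := by omega
      exact hempty y hy hxy.2
    · exact h.emptyNode_of_outside (by omega) (by omega) (by omega)
  have hhit : FirstHits n ω (topStart n g) l := by
    -- If both steps enter the node, the diagonal one lies above and belongs to the uppermost path.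
    by_cases hd : (.diagonal, n - 1, l) ∈ ω
    · refine ⟨_, h.reflTransGen_of_isTop (by omega) ⟨hd, ?_, ?_, ?_⟩, ?_, ?_⟩
      · intro x y hx hy
        simp only [src] at hx hy
        exact hquad x y hx (by omega)
      · exact (hquad n (l + 1) (by omega) (by omega)).northWest
      · rintro ⟨s, x', y'⟩ hf hs
        simp [src] at hs
        cases s <;> simp at hs <;> obtain ⟨rfl, rfl⟩ := hs
        · exact absurd hf (hquad n (l + 1) (by omega) (by omega)).west
        · exact le_rfl
        · simp [level]
      · simp [src]
        omega
      · simp [tgt]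
        omega
    · have hh := hin.resolve_right hd
      refine ⟨_, h.reflTransGen_of_isTop (by omega) ⟨hh, ?_, ?_, ?_⟩, ?_, ?_⟩
      · exact hquad
      · exact hd
      · rintro f hf hs
        simp [level]
      · simp [src]
        omega
      · simp [tgt]
        omega
  exact ⟨fun h' => h'.height_unique hhit, fun h' => h' ▸ hhit⟩

/-! ### Sums over configurations -/

/-- The summand vanishes unless all local rules hold: `w` enforces the ice rule and, for 6V, the
absence of diagonals; `bcWeight` and `midBC` enforce the boundary conditions. -/
theorem marginal_eq_sum_configs {D : Finset Dir} {n : ℕ} (hn : 1 ≤ n) {g : Bool}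
    (h1 : .horizontal ∈ D) (h2 : .vertical ∈ D) (hg : decide (Dir.diagonal ∈ D) = g)
    (w : Bool → Bool → Bool → Bool → Bool → Bool → Bool → ℂ)
    (hice : ∀ l E N W S d e, ¬ Ice E N W S d e → w l E N W S d e = 0)
    (hdiag : g = false → ∀ l E N W S d e, ¬ (d = false ∧ e = false) → w l E N W S d e = 0) :
    marginal (edges dirs20V n) (midBC n * ∏ p ∈ grid n, atNode (bcWeight n g w p) p)
        (fun _ => false) =
      ∑ ω ∈ configs D n, ∏ p ∈ grid n, atNode (w (decide (p.1 = n))) p (states ω) := by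
  classical
  have hov {ω : Finset Edge} (hω : ω ⊆ edges dirs20V n) :
      overlay (edges dirs20V n) ω (fun _ => false) = states ω := by
    ext e
    by_cases he : e ∈ edges dirs20V n
    · simp [overlay, states, he]
    · have : e ∉ ω := fun h => he (hω h)
      simp [overlay, states, he, this]
  rw [marginal]
  symm
  refine sum_subset_zero_on_sdiff (fun ω hω => ?_) (fun ω hω => ?_) (fun ω hω => ?_)
  · rw [mem_configs_iff hn h1 h2] at hω
    exact mem_powerset.2 hω.subset
  · rw [mem_sdiff, mem_powerset, mem_configs_iff hn h1 h2, hg] at hω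
    obtain ⟨hsub, hω⟩ := hω
    rw [hov hsub]
    by_contra hne
    refine hω ?_
    rw [Pi.mul_apply, Finset.prod_apply, ← ne_eq, mul_ne_zero_iff, prod_ne_zero_iff] at hne
    obtain ⟨hmid, hne⟩ := hne
    have hbc (p) (hp : p ∈ grid n) : atNode (LocalBC n g p) p (states ω) := by
      by_contra h
      exact hne p hp (if_neg h)
    have hw (p) (hp : p ∈ grid n) : atNode (w (decide (p.1 = n))) p (states ω) ≠ 0 := by
      have := hne p hp
      rwa [show atNode (bcWeight n g w p) p (states ω) =
        atNode (w (decide (p.1 = n))) p (states ω) from if_pos (hbc p hp)] at this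
    have hm : states ω (.horizontal, n, 1) = false ∧ states ω (.vertical, 1, n) = false := by
      by_contra h
      exact hmid (if_neg h)
    refine ⟨hsub, fun hgf e he hed => ?_, fun p hp => ?_, hbc, ?_, ?_⟩
    · rcases mem_edges20V_iff.1 (hsub he) with h | h
      · refine hw _ h (hdiag hgf _ _ _ _ _ _ _ fun h' => ?_)
        have h3 := (src_eq_iff h e).1 rfl
        rw [hed] at h3
        have h4 := h'.2
        rw [show (Dir.diagonal, (src e).1, (src e).2 - 1) = e from h3] at h4
        simp [states, he] at h4
      · refine hw _ h (hdiag hgf _ _ _ _ _ _ _ fun h' => ?_)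
        have h3 := (tgt_eq_iff h e).1 rfl
        rw [hed] at h3
        have h4 := h'.1
        rw [show (Dir.diagonal, (tgt e).1 - 1, (tgt e).2) = e from h3] at h4
        simp [states, he] at h4
    · by_contra h
      exact hw p hp (hice _ _ _ _ _ _ _ h)
    · simpa [states] using hm.1
    · simpa [states] using hm.2
  · rw [mem_configs_iff hn h1 h2, hg] at hω
    rw [hov hω.subset, Pi.mul_apply, Finset.prod_apply, midBC,
      if_pos ⟨by simpa [states] using hω.east, by simpa [states] using hω.north⟩, one_mul]
    exact prod_congr rfl fun p hp => (if_pos (hω.bc p hp)).symm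

/-- The hypothesis on `c` is the integrability relation for `a = 1`, `b = √2σ`. -/
theorem sum_configs_weight20_eq {c σ : ℂ} (hσ : σ ≠ 0) (hc : c ^ 2 = 1 + 2 * σ ^ 2 - 2 * σ) {n : ℕ}
    (hn : 1 ≤ n) :
    ∑ ω ∈ configs dirs20V n, ∏ p ∈ grid n,
        atNode (colParam weight20 1 (Real.sqrt 2 * σ) c (decide (p.1 = n))) p (states ω) =
      ∑ ω ∈ configs dirs6V n, ∏ p ∈ grid n, atNode (fun E N W S d e =>
        if d = false ∧ e = false then
          colParam weight6 1 (Real.sqrt 2 * σ) c (decide (p.1 = n)) E N W S else 0) p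
            (states ω) := by
  have h2 := sqrt_two_sq
  have hb := mul_ne_zero sqrt_two_ne_zero hσ
  rw [← marginal_eq_sum_configs (g := true) hn (by simp [dirs20V]) (by simp [dirs20V])
    (by simp [dirs20V]) (colParam weight20 1 (Real.sqrt 2 * σ) c),
    ← marginal_eq_sum_configs (g := false) hn (by simp [dirs6V]) (by simp [dirs6V])
    (by simp [dirs6V]) (fun l E N W S d e => if d = false ∧ e = false then
          colParam weight6 1 (Real.sqrt 2 * σ) c l E N W S else 0),
    marginal_weight20_eq_weight6 hb _ hn]
  · linear_combination hc + (σ - σ ^ 2) * h2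
  · intro l E N W S d e h
    split_ifs with h'
    · rw [h'.1, h'.2] at h
      cases l
      · exact weight6_eq_zero _ _ _ h
      · exact weight6_eq_zero _ _ _ h
    · rfl
  · intro _ l E N W S d e h
    exact if_neg h
  · intro l E N W S d e h
    cases l
    · exact weight20_eq_zero _ _ _ h
    · exact weight20_eq_zero _ _ _ h
  · simp

/-! ### The last column -/

lemma LocalRules.exists_last_column {n : ℕ} {g : Bool} {ω : Finset Edge} (h : LocalRules n g ω)
    (hn : 1 ≤ n) : ∃ l, (1 ≤ l ∧ l ≤ n) ∧ (∀ l', FirstHits n ω (topStart n g) l' ↔ l' = l) ∧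
      ∀ y, 1 ≤ y → y ≤ n → states ω (.horizontal, n, y) = false ∧
        states ω (.vertical, n, y) = decide (y < l) ∧
        states ω (.vertical, n, y - 1) = decide (y ≤ l) ∧
        states ω (.diagonal, n, y - 1) = (decide (y = 1) && g) := by
  -- The height `l` is the least `y` for which no step enters `(n, y)` from the North. As nothing
  -- leaves the column to the East above the bottom boundary, all nodes above `(n, l)` are empty.
  have hex : ∃ y, (Dir.vertical, n, y) ∉ ω := ⟨n, h.north_notMem hn⟩
  classical
  have hl1 : 1 ≤ Nat.find hex := by
    rw [Nat.one_le_iff_ne_zero]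
    intro h0
    have := Nat.find_spec hex
    rw [h0] at this
    exact this (h.south_mem ⟨hn, le_rfl⟩)
  have hln : Nat.find hex ≤ n := Nat.find_min' hex (h.north_notMem hn)
  have hlow : ∀ y, y < Nat.find hex → (Dir.vertical, n, y) ∈ ω := fun y hy => by
    simpa using Nat.find_min hex hy
  have hspec := Nat.find_spec hex
  generalize Nat.find hex = l at *
  have hdiag : ∀ y, 1 < y → (Dir.diagonal, n, y - 1) ∉ ω := fun y hy =>
    h.diagonal_east_notMem (by omega)
  have hup : ∀ k, l + 1 + k ≤ n → EmptyNode ω n (l + 1 + k) := by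
    intro k
    induction k with
    | zero =>
      exact fun hk => h.emptyNode_of_out ⟨hn, le_rfl⟩ ⟨by omega, hk⟩ (h.east_notMem (by omega))
        hspec (hdiag _ (by omega))
    | succ k ih =>
      exact fun hk => h.emptyNode_of_out ⟨hn, le_rfl⟩ ⟨by omega, hk⟩ (h.east_notMem (by omega))
        (ih (by omega)).north (hdiag _ (by omega))
  have hup' : ∀ y, l < y → y ≤ n → EmptyNode ω n y := by
    intro y h1 h2
    have := hup (y - l - 1)
    rw [show l + 1 + (y - l - 1) = y by omega] at this
    exact this h2
  have hhigh : ∀ y, l ≤ y → y ≤ n → (Dir.vertical, n, y) ∉ ω := by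
    intro y h1 h2
    rcases h1.eq_or_lt with rfl | h1
    · exact hspec
    · exact (hup' y h1 h2).north
  refine ⟨l, ⟨hl1, hln⟩, h.firstHits_iff ⟨hl1, hln⟩ hup' ?_, ?_⟩
  · rcases h.exists_in (x := n) (y := l) ⟨hn, le_rfl⟩ ⟨hl1, hln⟩ (hlow (l - 1) (by omega))
      (by simp [src]; omega) with h1 | h1 | h1
    · exact .inl h1
    · exact absurd h1 hspec
    · exact .inr h1
  · intro y hy1 hyn
    refine ⟨?_, ?_, ?_, ?_⟩
    · simpa [states] using h.east_notMem hy1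
    · rw [states, decide_eq_decide]
      refine ⟨fun hm => ?_, hlow y⟩
      by_contra hly
      exact hhigh y (by omega) hyn hm
    · rw [states, decide_eq_decide]
      refine ⟨fun hm => ?_, fun hy => hlow (y - 1) (by omega)⟩
      by_contra hly
      exact hhigh (y - 1) (by omega) (by omega) hm
    · rcases hy1.eq_or_lt with rfl | hy
      · have := h.diagonal_south_mem (x := n) ⟨hn, le_rfl⟩
        cases g <;> simpa [states] using this
      · simp [states, hdiag y hy, hy.ne']

lemma nodeWeight_eq {a b c : ℂ} {ω : Finset Edge} {p : ℕ × ℕ}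
    (h : Ice (states ω (.horizontal, p.1, p.2)) (states ω (.vertical, p.1, p.2))
      (states ω (.horizontal, p.1 - 1, p.2)) (states ω (.vertical, p.1, p.2 - 1)) false false) :
    nodeWeight a b c ω p = weight6 a b c (states ω (.horizontal, p.1, p.2))
      (states ω (.vertical, p.1, p.2)) (states ω (.horizontal, p.1 - 1, p.2))
      (states ω (.vertical, p.1, p.2 - 1)) := by
  revert h
  unfold nodeWeight weight6 states crossing Ice
  by_cases h1 : (Dir.horizontal, p.1, p.2) ∈ ω <;> by_cases h2 : (Dir.vertical, p.1, p.2) ∈ ω <;>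
    by_cases h3 : (Dir.horizontal, p.1 - 1, p.2) ∈ ω <;>
    by_cases h4 : (Dir.vertical, p.1, p.2 - 1) ∈ ω <;> simp [h1, h2, h3, h4]

lemma prod_grid_last_column {n l : ℕ} (hn : 1 ≤ n) (hl : 1 ≤ l ∧ l ≤ n) (c : ℂ) (f : ℕ → ℂ) :
    (∏ p ∈ grid n, if p.1 = n then (if l < p.2 then 1 else if p.2 = l then c else f p.2) else 1) =
      (∏ k ∈ range (l - 1), f (k + 1)) * c := by
  have h1 : (∏ p ∈ grid n,
      if p.1 = n then (if l < p.2 then 1 else if p.2 = l then c else f p.2) else 1) =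
      ∏ y ∈ Icc 1 n, if l < y then 1 else if y = l then c else f y := by
    rw [grid, prod_product, prod_eq_single n]
    · simp
    · intro x _ hx
      simp [hx]
    · intro hx
      simp [hn] at hx
  obtain ⟨k, rfl⟩ : ∃ k, l = k + 1 := ⟨l - 1, by omega⟩
  rw [h1, ← prod_subset (s₁ := Icc 1 (k + 1)), ← Finset.Ico_add_one_right_eq_Icc,
    prod_Ico_eq_prod_range]
  · rw [show k + 1 + 1 - 1 = k + 1 by omega, prod_range_succ, Nat.add_sub_cancel]
    congr 1
    · refine prod_congr rfl fun i hi => ?_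
      rw [mem_range] at hi
      rw [if_neg (by omega), if_neg (by omega), add_comm]
    · rw [if_neg (by omega), if_pos (by omega)]
  · exact Icc_subset_Icc_right hl.2
  · intro y hy hy'
    rw [mem_Icc] at hy hy'
    rw [if_pos (by omega)]

/-- Relative weight of the last column as a function of the height of the highest visited node. -/
noncomputable def columnWeight (σ : ℂ) (l : ℕ) : ℂ :=
  if l = 1 then 1 else σ * (2 * σ - 1) ^ (l - 2)

/-- Nodes above height `l` are empty and the node at `l` contributes `c`. Below it every node
contributes `2σ - 1`, except the bottom one, which contributes `σ`. Whether a path enters from the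
West or along the diagonal does not matter. -/
lemma exists_height20 {n : ℕ} (hn : 1 ≤ n) {c σ : ℂ} (hσ : σ ≠ 0) {ω : Finset Edge}
    (hω : ω ∈ configs dirs20V n) :
    ∃ l ∈ Icc 1 n, (∀ l', FirstHits n ω (start20V n) l' ↔ l' = l) ∧
      ∏ p ∈ grid n, atNode (colParam weight20 1 (Real.sqrt 2 * σ) c (decide (p.1 = n))) p
        (states ω) = 1 * (columnWeight σ l * c) := by
  have h2 := sqrt_two_sq
  have h0 := sqrt_two_ne_zero
  have hb := mul_ne_zero h0 hσ
  have h : LocalRules n true ω := by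
    simpa [dirs20V] using (mem_configs_iff hn (by simp [dirs20V]) (by simp [dirs20V])).1 hω
  obtain ⟨l, hl, hhit, hcol⟩ := h.exists_last_column hn
  refine ⟨l, mem_Icc.2 hl, hhit, ?_⟩
  have : (∏ k ∈ range (l - 1), if k + 1 = 1 then σ else 2 * σ - 1) = columnWeight σ l := by
    rw [columnWeight]
    split_ifs with hl1
    · simp [hl1]
    · obtain ⟨k, rfl⟩ : ∃ k, l = k + 2 := ⟨l - 2, by omega⟩
      rw [show k + 2 - 1 = k + 1 by omega, prod_range_succ', mul_comm]
      simp
  rw [← this, one_mul, ← prod_grid_last_column hn hl c fun y => if y = 1 then σ else 2 * σ - 1]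
  refine prod_congr rfl fun p hp => ?_
  obtain ⟨x, y⟩ := p
  have hi := h.ice _ hp
  by_cases h1 : x = n
  · subst h1
    simp only [grid, mem_product, mem_Icc] at hp
    obtain ⟨e1, e2, e3, e4⟩ := hcol y hp.2.1 hp.2.2
    unfold atNode at hi ⊢
    simp only [colParam, decide_true, if_true, e1, e2, e3, e4, Bool.and_true] at hi ⊢
    generalize states ω (.horizontal, x - 1, y) = W at hi ⊢
    generalize states ω (.diagonal, x - 1, y) = d at hi ⊢
    rcases lt_trichotomy l y with hly | rfl | hly
    · have hy1 : y ≠ 1 := by omega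
      rw [if_pos hly]
      simp only [hy1, hly.not_gt, hly.not_ge, decide_false] at hi ⊢
      cases W <;> cases d <;> simp [Ice] at hi
      exact weight20_empty 1 c
    · rw [if_neg (lt_irrefl _), if_pos rfl]
      by_cases hy1 : l = 1
      · simp only [hy1, lt_irrefl, le_refl, decide_true, decide_false] at hi ⊢
        cases W <;> cases d <;> simp [Ice] at hi
        exact weight20_corner_turn 1 c
      · simp only [hy1, lt_irrefl, le_refl, decide_true, decide_false] at hi ⊢
        refine weight20_turn 1 c hb W d ?_
        cases W <;> cases d <;> simp [Ice] at hi <;> rfl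
    · rw [if_neg hly.not_gt, if_neg hly.ne]
      by_cases hy1 : y = 1
      · simp only [hy1 ▸ hly, (hy1 ▸ hly).le, hy1, decide_true, if_true] at hi ⊢
        rw [weight20_corner_straight 1 c hb W d, mul_div_cancel_left₀ _ h0]
        cases W <;> cases d <;> simp [Ice] at hi <;> rfl
      · simp only [hly, hly.le, hy1, decide_true, decide_false, if_false] at hi ⊢
        cases W <;> cases d <;> simp [Ice] at hi
        rw [weight20_straight 1 c hb]
        linear_combination σ * h2
  · rw [if_neg h1]
    simp only [h1, decide_false]
    exact weight20_one hi

/-- Compared with `1, √2, 1`, the turn at height `l` gains `c` and each of the `l - 1` straight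
passages below gains `σ`. -/
lemma exists_height6 {n : ℕ} (hn : 1 ≤ n) {c σ : ℂ} {ω : Finset Edge}
    (hω : ω ∈ configs dirs6V n) :
    ∃ l ∈ Icc 1 n, (∀ l', FirstHits n ω (start6V n) l' ↔ l' = l) ∧
      ∏ p ∈ grid n, atNode (fun E N W S d e =>
        if d = false ∧ e = false then
          colParam weight6 1 (Real.sqrt 2 * σ) c (decide (p.1 = n)) E N W S else 0) p
            (states ω) =
        (∏ p ∈ grid n, nodeWeight 1 (Real.sqrt 2 : ℂ) 1 ω p) * (σ ^ (l - 1) * c) := by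
  have h : LocalRules n false ω := by
    simpa [dirs6V] using (mem_configs_iff hn (by simp [dirs6V]) (by simp [dirs6V])).1 hω
  obtain ⟨l, hl, hhit, hcol⟩ := h.exists_last_column hn
  refine ⟨l, mem_Icc.2 hl, hhit, ?_⟩
  have : (∏ k ∈ range (l - 1), σ) = σ ^ (l - 1) := by simp
  rw [← this, ← prod_grid_last_column hn hl c fun _ => σ, ← prod_mul_distrib]
  refine prod_congr rfl fun p hp => ?_
  obtain ⟨x, y⟩ := p
  have hi := h.ice _ hp
  have hd {x y : ℕ} : states ω (.diagonal, x, y) = false := by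
    simp only [states, decide_eq_false_iff_not]
    exact fun hm => h.diagonal rfl _ hm rfl
  unfold atNode at hi ⊢
  simp only [hd, and_self, if_true] at hi ⊢
  rw [nodeWeight_eq hi]
  by_cases h1 : x = n
  · subst h1
    simp only [grid, mem_product, mem_Icc] at hp
    obtain ⟨e1, e2, e3, -⟩ := hcol y hp.2.1 hp.2.2
    simp only [colParam, decide_true, if_true, e1, e2, e3] at hi ⊢
    generalize states ω (.horizontal, x - 1, y) = W at hi ⊢
    rcases lt_trichotomy l y with hly | rfl | hly
    · rw [if_pos hly]
      simp only [hly.not_gt, hly.not_ge, decide_false] at hi ⊢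
      cases W <;> simp [Ice] at hi
      simp [weight6, crossing]
    · rw [if_neg (lt_irrefl _), if_pos rfl]
      simp only [lt_irrefl, le_refl, decide_true, decide_false] at hi ⊢
      cases W <;> simp [Ice] at hi
      simp [weight6, crossing]
    · rw [if_neg hly.not_gt, if_neg hly.ne]
      simp only [hly, hly.le, decide_true] at hi ⊢
      cases W <;> simp [Ice] at hi
      simp [weight6, crossing]
  · rw [if_neg h1, mul_one]
    simp only [h1, decide_false]
    rfl

lemma sum_eq_sum_heights {n : ℕ} (s : Finset (Finset Edge)) (H : Finset Edge → ℕ → Prop)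
    [∀ l, DecidablePred fun ω => H ω l] (F G : Finset Edge → ℂ) (ψ : ℕ → ℂ)
    (h : ∀ ω ∈ s, ∃ l ∈ Icc 1 n, (∀ l', H ω l' ↔ l' = l) ∧ F ω = G ω * ψ l) :
    ∑ ω ∈ s, F ω = ∑ l ∈ Icc 1 n, (∑ ω ∈ s with H ω l, G ω) * ψ l := by
  simp only [sum_mul, sum_filter]
  rw [sum_comm]
  refine sum_congr rfl fun ω hω => ?_
  obtain ⟨l, hl, hH, hF⟩ := h ω hω
  simp only [hH, ite_mul, zero_mul]
  rw [sum_ite_eq' _ _ _, if_pos hl, hF]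

/-- The generating polynomials agree up to a change of the weights of the last column. -/
theorem sum_Z20VBC1_mul_columnWeight {n : ℕ} (hn : 1 ≤ n) (σ : ℂ) :
    ∑ l ∈ Icc 1 n, (Z20VBC1 n l : ℂ) * columnWeight σ l = hatZ6V 1 (Real.sqrt 2 : ℂ) 1 n σ := by
  have key {σ : ℂ} (hσ : σ ≠ 0) (hσ' : 1 + 2 * σ ^ 2 - 2 * σ ≠ 0) :
      ∑ l ∈ Icc 1 n, (Z20VBC1 n l : ℂ) * columnWeight σ l =
        hatZ6V 1 (Real.sqrt 2 : ℂ) 1 n σ := by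
    classical
    obtain ⟨c, hc⟩ := IsAlgClosed.exists_pow_nat_eq (1 + 2 * σ ^ 2 - 2 * σ) (n := 2) (by norm_num)
    have hc0 : c ≠ 0 := by
      rintro rfl
      rw [← hc] at hσ'
      simp at hσ'
    refine mul_right_cancel₀ hc0 ?_
    have h := sum_configs_weight20_eq hσ hc hn
    rw [sum_eq_sum_heights _ (fun ω => FirstHits n ω (start20V n)) _ (fun _ => 1) _
      (fun ω hω => exists_height20 hn hσ hω),
      sum_eq_sum_heights _ (fun ω => FirstHits n ω (start6V n)) _ _ _
      (fun ω hω => exists_height6 hn hω)] at h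
    rw [hatZ6V, sum_mul, sum_mul]
    convert h using 2 with l _ l _
    · rw [Z20VBC1, mul_assoc]
      congr 1
      simp
    · rw [Z6V, mul_assoc]
  -- The values `σ = 0` and those with `c = 0` are excluded so far; both sides are polynomials in
  -- `σ`, so the identity extends to them.
  let P : Polynomial ℂ := ∑ l ∈ Icc 1 n, Polynomial.C (Z20VBC1 n l : ℂ) *
    (if l = 1 then 1 else Polynomial.X * (2 * Polynomial.X - 1) ^ (l - 2)) -
      ∑ l ∈ Icc 1 n, Polynomial.C (Z6V 1 (Real.sqrt 2 : ℂ) 1 n l) * Polynomial.X ^ (l - 1)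
  have hP (σ : ℂ) : P.eval σ = ∑ l ∈ Icc 1 n, (Z20VBC1 n l : ℂ) * columnWeight σ l -
      hatZ6V 1 (Real.sqrt 2 : ℂ) 1 n σ := by
    simp only [P, hatZ6V, columnWeight, Polynomial.eval_sub, Polynomial.eval_finsetSum,
      Polynomial.eval_mul, Polynomial.eval_C, Polynomial.eval_pow, Polynomial.eval_X]
    congr 1
    refine sum_congr rfl fun l _ => ?_
    split_ifs <;> simp
  have hzero : Polynomial.X * (1 + 2 * Polynomial.X ^ 2 - 2 * Polynomial.X) * P = 0 := by
    refine Polynomial.funext fun σ => ?_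
    by_cases hσ : σ = 0
    · simp [hσ]
    by_cases hσ' : 1 + 2 * σ ^ 2 - 2 * σ = 0
    · simp [hσ']
    · simp [hP, key hσ hσ']
  have hne : (Polynomial.X * (1 + 2 * Polynomial.X ^ 2 - 2 * Polynomial.X) : Polynomial ℂ) ≠ 0 := by
    intro h
    have := congrArg (Polynomial.eval 1) h
    norm_num at this
  have := hP σ
  rw [(mul_eq_zero.1 hzero).resolve_left hne, Polynomial.eval_zero] at this
  exact (sub_eq_zero.1 this.symm)

end VertexModel

theorem mainTheorem7 (n : ℕ) (hn : 1 ≤ n) (τ : ℂ) (hτ : τ ≠ -1) :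
    VertexModel.hatZ20VBC1 n τ =
      2 * τ / (1 + τ) * VertexModel.hatZ6V 1 (Real.sqrt 2 : ℂ) 1 n ((1 + τ) / 2) +
        (1 - τ) / (1 + τ) * VertexModel.hatZ6V 1 (Real.sqrt 2 : ℂ) 1 n 0 := by
  have h : 1 + τ ≠ 0 := fun h => hτ (by linear_combination h)
  -- At `σ = 0` only `l = 1` survives, so the second 6V value isolates that term and corrects its
  -- coefficient; the identity is then checked for each `l`.
  rw [← VertexModel.sum_Z20VBC1_mul_columnWeight hn, ← VertexModel.sum_Z20VBC1_mul_columnWeight hn,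
    VertexModel.hatZ20VBC1, Finset.mul_sum, Finset.mul_sum, ← Finset.sum_add_distrib]
  refine Finset.sum_congr rfl fun l hl => ?_
  rw [VertexModel.columnWeight, VertexModel.columnWeight]
  split_ifs with hl1
  · subst hl1
    field_simp
    ring
  · obtain ⟨k, rfl⟩ : ∃ k, l = k + 2 := ⟨l - 2, by have := Finset.mem_Icc.1 hl; omega⟩
    rw [show 2 * ((1 + τ) / 2) - 1 = τ by ring, show k + 2 - 1 = k + 1 by omega,
      Nat.add_sub_cancel]
    field_simp
    ring
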